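/- The augmented cube $AQ_n$ is the graph on the bit strings of length $n$ defined recursively: $AQ_1=K_2$, and for $n\ge 2$, $AQ_n$ consists of two copies of $AQ_{n-1}$, whose vertices are prefixed by $0$ and by $1$ respectively, together with the edges joining $0x$ to $1x$ and $0x$ to $1\overline{x}$ for every bit string $x$ of length $n-1$, where $\overline{x}$ is the bitwise complement of $x$. For a graph $G$ and a set $D\subseteq V(G)$ with $|D|\ge 2$, a $D$-path is a path of $G$ containing all vertices of $D$. $D$-paths $P_1,\dots,P_m$ are internally disjoint if $V(P_i)\cap V(P_j)=D$ and $E(P_i)\cap E(P_j)=\emptyset$ for all $i\ne j$. Let $\pi_G(D)$ be the maximum number of internally disjoint $D$-paths in $G$, and for $2\le k\le |V(G)|$ let $\pi_k(G)=\min\{\pi_G(D) : D\subseteq V(G),\ |D|=k\}$ be the $k$-path-connectivity of $G$. **Corollary.** For every odd $n\ge 3$, $$\pi_3(AQ_n)=\frac{3(n-1)}{2}-1.$$ -/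

import Mathlib

/-- Adjacency in the augmented cube `AQ_n`, by recursion on the dimension.  A vertex is a bit string
`x : Fin n → Bool`, whose first bit is `x 0`.  `AQ_(n+1)` consists of two copies of `AQ_n` (the
strings with first bit `0` and those with first bit `1`), together with the hypercubic edges
(first bits differ, remaining bits agree) and the complementary edges (first bits differ, remaining
bits are complementary).  `AQ_0` is a single vertex, so that `AQ_1 = K_2`. -/
def AugAdj : (n : ℕ) → (Fin n → Bool) → (Fin n → Bool) → Prop
  | 0, _, _ => False
  | n + 1, x, y =>
      (x 0 = y 0 ∧ AugAdj n (Fin.tail x) (Fin.tail y)) ∨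
      (x 0 ≠ y 0 ∧ (Fin.tail y = Fin.tail x ∨ Fin.tail y = fun i => !(Fin.tail x i)))

theorem augAdj_symm : ∀ (n : ℕ) (x y : Fin n → Bool), AugAdj n x y → AugAdj n y x
  | 0, _, _ => fun h => h
  | n + 1, x, y => by
      rintro (⟨h0, h⟩ | ⟨h0, h | h⟩)
      · exact Or.inl ⟨h0.symm, augAdj_symm n _ _ h⟩
      · exact Or.inr ⟨h0.symm, Or.inl h.symm⟩
      · refine Or.inr ⟨h0.symm, Or.inr ?_⟩
        rw [h]
        funext i
        simp

theorem augAdj_irrefl : ∀ (n : ℕ) (x : Fin n → Bool), ¬ AugAdj n x x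
  | 0, _ => fun h => h
  | n + 1, x => by
      rintro (⟨_, h⟩ | ⟨h0, _⟩)
      · exact augAdj_irrefl n _ h
      · exact h0 rfl

/-- The augmented cube `AQ_n`, on the `2 ^ n` bit strings of length `n`. -/
def augmentedCube (n : ℕ) : SimpleGraph (Fin n → Bool) where
  Adj := AugAdj n
  symm := ⟨augAdj_symm n⟩
  loopless := ⟨augAdj_irrefl n⟩

/-- A `D`-path of `G`: a path of `G` that contains all the vertices of `D`. -/
def IsDPath {V : Type*} (G : SimpleGraph V) (D : Finset V) {u v : V} (p : G.Walk u v) : Prop :=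
  p.IsPath ∧ ∀ w ∈ D, w ∈ p.support

/-- `G` has `m` internally disjoint `D`-paths `P_1, …, P_m`: for `i ≠ j` one has
`V(P_i) ∩ V(P_j) = D` and `E(P_i) ∩ E(P_j) = ∅`.  The endpoints of the paths are arbitrary. -/
def HasDisjointDPaths {V : Type*} (G : SimpleGraph V) (D : Finset V) (m : ℕ) : Prop :=
  ∃ (s t : Fin m → V) (P : (i : Fin m) → G.Walk (s i) (t i)),
    (∀ i, IsDPath G D (P i)) ∧
    ∀ i j, i ≠ j →
      {w | w ∈ (P i).support} ∩ {w | w ∈ (P j).support} = (D : Set V) ∧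
      {e | e ∈ (P i).edges} ∩ {e | e ∈ (P j).edges} = ∅

/-- `π_G(D)`, the maximum number of internally disjoint `D`-paths of `G`
(in `ℕ∞`, where every set has a supremum). -/
noncomputable def pathNumber {V : Type*} (G : SimpleGraph V) (D : Finset V) : ℕ∞ :=
  sSup {a : ℕ∞ | ∃ m : ℕ, a = (m : ℕ∞) ∧ HasDisjointDPaths G D m}

/-- The `k`-path-connectivity `π_k(G)`: the minimum of `π_G(D)` over the sets `D` of `k` vertices. -/
noncomputable def pathConnectivity {V : Type*} (k : ℕ) (G : SimpleGraph V) : ℕ∞ :=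
  sInf {a : ℕ∞ | ∃ D : Finset V, D.card = k ∧ a = pathNumber G D}

/-! In the coordinates x_0, x_0 + x_1, x_1 + x_2, … the augmented cube becomes the Cayley graph of
(Z/2)^n generated by the unit vectors e_m and the sums e_m + e_{m+1} (`augmentedCubeIso`,
`flipGraph`), with 2n - 1 generators. Write n = 2k + 1; the claimed value is 3k - 1.

Upper bound (`HasDisjointDPaths.four_mul_add_le`). A path through three vertices uses at least four
edge-ends at D. A common neighbour c of all three lies on at most one of the paths, and that path
has at most two edges at c, so one of the three edges from c to D is wasted. The vertices 0, 101,
111 (followed by zeros) have four common neighbours, whence 4m + 4 ≤ 3(2n - 1) = 12k + 3 and m ≤ 3k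
- 1.

Lower bound (`hasDisjointDPaths_of_halves`). Some coordinate i separates one vertex z of D from the
other two, x and y. Each half with fixed i-th coordinate is (4k - 2)-connected
(`connectedWithin_subcube_erase`). By Menger's theorem the half of x and y contains 4k - 2
internally disjoint x-y paths. Of these, 2k - 2 are cut open: their first and last interior
vertices, together with x and y, cross to the other half along e_i and continue to z along a fan.
This leaves 2k segments xy, 2k - 1 segments xz and 2k - 1 segments yz, which pair up to 3k - 1
paths.

A path can be cut only if it has two distinct interior vertices at its ends, so at most 2k of the
x-y paths may be the edge xy or have a single interior vertex. Two vertices have at most four common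
neighbours, which settles all k except k = 2 with x, y adjacent. There a different splitting
coordinate helps, except for D = {x, x + e_1, x + e_3}, where five paths are exhibited. -/

/-! ### Walks confined to a vertex set. -/

/-- `a` and `b` are joined by a walk of `G` all of whose vertices lie in `U`. -/
def JoinedWithin {V : Type*} (G : SimpleGraph V) (U : Set V) (a b : V) : Prop :=
  a ∈ U ∧ Relation.ReflTransGen (fun u v => G.Adj u v ∧ v ∈ U) a b

namespace JoinedWithin

variable {V : Type*} {G G' : SimpleGraph V} {U U' : Set V} {a b c : V}

theorem refl (h : a ∈ U) : JoinedWithin G U a a := ⟨h, .refl⟩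

theorem left_mem (h : JoinedWithin G U a b) : a ∈ U := h.1

theorem right_mem (h : JoinedWithin G U a b) : b ∈ U := by
  obtain ⟨ha, h⟩ := h
  cases h with
  | refl => exact ha
  | tail _ h => exact h.2

theorem tail (h : JoinedWithin G U a b) (hbc : G.Adj b c) (hc : c ∈ U) : JoinedWithin G U a c :=
  ⟨h.1, h.2.tail ⟨hbc, hc⟩⟩

theorem trans (h : JoinedWithin G U a b) (h' : JoinedWithin G U b c) : JoinedWithin G U a c :=
  ⟨h.1, h.2.trans h'.2⟩

theorem of_adj (h : G.Adj a b) (ha : a ∈ U) (hb : b ∈ U) : JoinedWithin G U a b :=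
  (refl ha).tail h hb

theorem induct {P : V → Prop} (h : JoinedWithin G U a b) (h0 : P a)
    (hs : ∀ u v, JoinedWithin G U a u → P u → G.Adj u v → v ∈ U → P v) : P b := by
  obtain ⟨ha, h⟩ := h
  induction h with
  | refl => exact h0
  | tail h1 h2 ih => exact hs _ _ ⟨ha, h1⟩ ih h2.1 h2.2

theorem symm (h : JoinedWithin G U a b) : JoinedWithin G U b a :=
  h.induct (P := fun b => JoinedWithin G U b a) (refl h.1)
    fun _ _ h1 ih hadj hv => (of_adj hadj.symm hv h1.right_mem).trans ih

theorem mono (h : JoinedWithin G U a b) (hG : G ≤ G') (hU : U ⊆ U') : JoinedWithin G' U' a b :=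
  h.induct (refl (hU h.1)) fun _ _ _ ih hadj hv => ih.tail (hG hadj) (hU hv)

theorem reachable_set (h : JoinedWithin G U a b) :
    JoinedWithin G {v | JoinedWithin G U a v} a b :=
  h.induct (refl (refl h.1)) fun _ _ h1 ih hadj hv => ih.tail hadj (h1.tail hadj hv)

/-- Follow a walk until it first meets `X`. -/
theorem first_hit (h : JoinedWithin G U a b) (X : Set V) :
    JoinedWithin G (U \ X) a b ∨ a ∈ X ∨
      ∃ u s, JoinedWithin G (U \ X) a u ∧ G.Adj u s ∧ s ∈ X ∧ s ∈ U := by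
  by_cases haX : a ∈ X
  · exact Or.inr (Or.inl haX)
  refine h.induct (P := fun b => JoinedWithin G (U \ X) a b ∨ a ∈ X ∨
      ∃ u s, JoinedWithin G (U \ X) a u ∧ G.Adj u s ∧ s ∈ X ∧ s ∈ U)
    (Or.inl (refl ⟨h.1, haX⟩)) ?_
  rintro u v - (ih | ih) hadj hv
  · by_cases hvX : v ∈ X
    · exact Or.inr (Or.inr ⟨u, v, ih, hadj, hvX, hv⟩)
    · exact Or.inl (ih.tail hadj ⟨hv, hvX⟩)
  · exact Or.inr ih

theorem exists_isPath (h : JoinedWithin G U a b) :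
    ∃ p : G.Walk a b, p.IsPath ∧ ∀ v ∈ p.support, v ∈ U := by
  classical
  suffices ∃ p : G.Walk a b, ∀ v ∈ p.support, v ∈ U by
    obtain ⟨p, hp⟩ := this
    exact ⟨p.bypass, p.bypass_isPath, fun v hv => hp v (p.support_bypass_subset_support hv)⟩
  refine h.induct (P := fun b => ∃ p : G.Walk a b, ∀ v ∈ p.support, v ∈ U)
    ⟨.nil, by simpa using h.1⟩ ?_
  rintro u v - ⟨p, hp⟩ hadj hv
  refine ⟨p.concat hadj, fun w hw => ?_⟩
  rw [SimpleGraph.Walk.support_concat] at hw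
  simp only [List.mem_append, List.mem_singleton] at hw
  rcases hw with hw | rfl
  · exact hp w hw
  · exact hv

/-- A walk either avoids the edge `xy` or splits at it. -/
theorem deleteEdge {x y : V} (h : JoinedWithin G U a b) :
    let G' := G.deleteEdges {s(x, y)}
    JoinedWithin G' U a b ∨ (JoinedWithin G' U a x ∧ JoinedWithin G' U y b) ∨
      (JoinedWithin G' U a y ∧ JoinedWithin G' U x b) := by
  intro G'
  refine h.induct (P := fun b => JoinedWithin G' U a b ∨
    (JoinedWithin G' U a x ∧ JoinedWithin G' U y b) ∨
      (JoinedWithin G' U a y ∧ JoinedWithin G' U x b)) (Or.inl (refl h.1)) ?_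
  intro u v _ ih hadj hv
  by_cases he : s(u, v) = s(x, y)
  · rw [Sym2.eq_iff] at he
    rcases he with ⟨rfl, rfl⟩ | ⟨rfl, rfl⟩
    · rcases ih with ih | ⟨ih, -⟩ | ⟨ih, -⟩
      · exact Or.inr (Or.inl ⟨ih, refl hv⟩)
      · exact Or.inr (Or.inl ⟨ih, refl hv⟩)
      · exact Or.inl ih
    · rcases ih with ih | ⟨ih, -⟩ | ⟨ih, -⟩
      · exact Or.inr (Or.inr ⟨ih, refl hv⟩)
      · exact Or.inl ih
      · exact Or.inr (Or.inr ⟨ih, refl hv⟩)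
  · have hadj' : G'.Adj u v := by
      simpa [G', SimpleGraph.deleteEdges_adj] using ⟨hadj, by simpa using he⟩
    rcases ih with ih | ⟨h1, ih⟩ | ⟨h1, ih⟩
    · exact Or.inl (ih.tail hadj' hv)
    · exact Or.inr (Or.inl ⟨h1, ih.tail hadj' hv⟩)
    · exact Or.inr (Or.inr ⟨h1, ih.tail hadj' hv⟩)

end JoinedWithin

/-! ### Separators, linkages and Menger's theorem. -/

/-- Every set of fewer than `k` vertices is avoided by some walk from `A` to `B`. -/
def NoSmallSeparator {V : Type*} (G : SimpleGraph V) (A B : Set V) (k : ℕ) : Prop :=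
  ∀ W : Finset V, W.card < k → ∃ a ∈ A, ∃ b ∈ B, JoinedWithin G (W : Set V)ᶜ a b

/-- There are `k` disjoint vertex sets, each carrying a walk from `A` to `B`. -/
structure Linkage {V : Type*} (G : SimpleGraph V) (A B : Set V) (k : ℕ) where
  carrier : Fin k → Set V
  src : Fin k → V
  tgt : Fin k → V
  src_mem : ∀ i, src i ∈ A
  tgt_mem : ∀ i, tgt i ∈ B
  joined : ∀ i, JoinedWithin G (carrier i) (src i) (tgt i)
  disj : ∀ i j v, v ∈ carrier i → v ∈ carrier j → i = j

namespace Linkage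

variable {V : Type*} {G : SimpleGraph V} {A B : Set V} {k : ℕ}

theorem tgt_injective (L : Linkage G A B k) : Function.Injective L.tgt := fun i j h =>
  L.disj i j (L.tgt i) (L.joined i).right_mem (h ▸ (L.joined j).right_mem)

theorem src_injective (L : Linkage G A B k) : Function.Injective L.src := fun i j h =>
  L.disj i j (L.src i) (L.joined i).left_mem (h ▸ (L.joined j).left_mem)

/-- Each walk is stopped at its first vertex in B. Afterwards a carrier meets B only in its target,
which is what makes gluing along a separator possible. -/
theorem exists_trimmed (L : Linkage G A B k) :
    ∃ L' : Linkage G A B k, ∀ i, ∀ v ∈ L'.carrier i,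
      v = L'.tgt i ∨ JoinedWithin G Bᶜ (L'.src i) v := by
  have key : ∀ i, ∃ s ∈ B, s ∈ L.carrier i ∧
      JoinedWithin G (insert s {v | JoinedWithin G (L.carrier i \ B) (L.src i) v}) (L.src i) s := by
    intro i
    rcases (L.joined i).first_hit B with h | h | ⟨u, s, h, hadj, hsB, hs⟩
    · exact absurd (L.tgt_mem i) h.right_mem.2
    · exact ⟨_, h, (L.joined i).left_mem, .refl (Set.mem_insert _ _)⟩
    · exact ⟨s, hsB, hs, (h.reachable_set.mono le_rfl (Set.subset_insert _ _)).tail hadj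
        (Set.mem_insert _ _)⟩
  choose s hsB hs hj using key
  refine ⟨⟨fun i => insert (s i) {v | JoinedWithin G (L.carrier i \ B) (L.src i) v}, L.src, s,
    L.src_mem, hsB, hj, ?_⟩, ?_⟩
  · have hsub : ∀ i v, v ∈ insert (s i) {v | JoinedWithin G (L.carrier i \ B) (L.src i) v} →
        v ∈ L.carrier i := by
      rintro i v (rfl | h)
      · exact hs i
      · exact h.right_mem.1
    exact fun i j v hi hj => L.disj i j v (hsub i v hi) (hsub j v hj)
  · rintro i v (rfl | h)
    · exact Or.inl rfl
    · exact Or.inr (h.mono le_rfl fun w hw => hw.2)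

end Linkage

theorem NoSmallSeparator.symm {V : Type*} {G : SimpleGraph V} {A B : Set V} {k : ℕ}
    (h : NoSmallSeparator G A B k) : NoSmallSeparator G B A k := fun W hW => by
  obtain ⟨a, ha, b, hb, h⟩ := h W hW
  exact ⟨b, hb, a, ha, h.symm⟩

section Menger

variable {V : Type*} {G : SimpleGraph V} {A B : Set V} {k : ℕ} {x y : V} {S : Finset V}

theorem JoinedWithin.deleteEdge_of_notMem {U : Set V} {a b : V} (h : JoinedWithin G U a b)
    (hx : x ∉ U) : JoinedWithin (G.deleteEdges {s(x, y)}) U a b := by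
  rcases h.deleteEdge (x := x) (y := y) with h | ⟨h, -⟩ | ⟨-, h⟩
  · exact h
  · exact absurd h.right_mem hx
  · exact absurd h.left_mem hx

/-- A walk of G from A to B that avoids W is followed until it first meets S ∪ {x}. It must do so,
since otherwise it avoids the edge xy and contradicts the separation by S. Nor can its last step be
y to x, because y is still joined to B off S. -/
theorem NoSmallSeparator.deleteEdge_half [DecidableEq V] (h : NoSmallSeparator G A B k)
    (hS : ∀ a ∈ A, ∀ b ∈ B, ¬ JoinedWithin (G.deleteEdges {s(x, y)}) (S : Set V)ᶜ a b)
    (hy : ∃ b ∈ B, JoinedWithin (G.deleteEdges {s(x, y)}) (S : Set V)ᶜ y b) :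
    NoSmallSeparator (G.deleteEdges {s(x, y)}) A (insert x S : Finset V) k := by
  intro W hW
  obtain ⟨a, ha, b, hb, hab⟩ := h W hW
  have hsub : ((W : Set V)ᶜ \ (insert x S : Finset V)) ⊆ (S : Set V)ᶜ := by
    rintro v ⟨-, hv⟩ hvS
    exact hv (by simpa using Or.inr hvS)
  have hxn : x ∉ ((W : Set V)ᶜ \ (insert x S : Finset V)) := fun h => h.2 (by simp)
  rcases hab.first_hit (insert x S : Finset V) with h1 | h1 | ⟨u, s, h1, hadj, hs, hsU⟩
  · exact absurd ((h1.deleteEdge_of_notMem hxn).mono le_rfl hsub) (hS a ha b hb)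
  · exact ⟨a, ha, a, h1, .refl hab.left_mem⟩
  · have h2 := h1.deleteEdge_of_notMem (y := y) hxn
    by_cases he : s(u, s) = s(x, y)
    · rw [Sym2.eq_iff] at he
      rcases he with ⟨rfl, rfl⟩ | ⟨rfl, rfl⟩
      · exact absurd h1.right_mem hxn
      · obtain ⟨b', hb', hy⟩ := hy
        exact absurd ((h2.mono le_rfl hsub).trans hy) (hS a ha b' hb')
    · refine ⟨a, ha, s, hs, (h2.mono le_rfl fun v hv => hv.1).tail ?_ hsU⟩
      simpa [SimpleGraph.deleteEdges_adj] using ⟨hadj, by simpa using he⟩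

theorem NoSmallSeparator.le_card_insert [DecidableEq V] (h : NoSmallSeparator G A B k)
    (hS : ∀ a ∈ A, ∀ b ∈ B, ¬ JoinedWithin (G.deleteEdges {s(x, y)}) (S : Set V)ᶜ a b) :
    k ≤ (insert x S).card := by
  by_contra hlt
  obtain ⟨a, ha, b, hb, hab⟩ := h (insert x S) (by omega)
  have := hab.deleteEdge_of_notMem (x := x) (y := y) (by simp)
  exact hS a ha b hb (this.mono le_rfl (by simp))

/-- Two linkages that end at the two sides of a separated edge are glued together. -/
theorem Linkage.glue [DecidableEq V] (hadj : G.Adj x y)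
    (hxS : x ∉ S) (hyS : y ∉ S) (hcard : S.card + 1 = k)
    (hS : ∀ a ∈ A, ∀ b ∈ B, ¬ JoinedWithin (G.deleteEdges {s(x, y)}) (S : Set V)ᶜ a b)
    (hx : ∃ a ∈ A, JoinedWithin (G.deleteEdges {s(x, y)}) (S : Set V)ᶜ a x)
    (hy : ∃ b ∈ B, JoinedWithin (G.deleteEdges {s(x, y)}) (S : Set V)ᶜ y b)
    (L : Linkage (G.deleteEdges {s(x, y)}) A (insert x S : Finset V) k)
    (M : Linkage (G.deleteEdges {s(x, y)}) B (insert y S : Finset V) k) :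
    Nonempty (Linkage G A B k) := by
  set G' := G.deleteEdges {s(x, y)} with hG'
  obtain ⟨L, hL⟩ := L.exists_trimmed
  obtain ⟨M, hM⟩ := M.exists_trimmed
  have hsurj : ∀ t ∈ insert y S, ∃ j, M.tgt j = t := by
    have himg : Finset.univ.image M.tgt = insert y S := by
      refine Finset.eq_of_subset_of_card_le ?_ ?_
      · intro v hv
        obtain ⟨j, -, rfl⟩ := Finset.mem_image.1 hv
        exact M.tgt_mem j
      · rw [Finset.card_image_of_injective _ M.tgt_injective, Finset.card_insert_of_notMem hyS]
        simp [hcard]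
    intro t ht
    rw [← himg] at ht
    simpa using ht
  have hτ : ∀ i, ∃ j, (L.tgt i = x ∧ M.tgt j = y) ∨ (L.tgt i ∈ S ∧ M.tgt j = L.tgt i) := by
    intro i
    have := L.tgt_mem i
    simp only [Finset.coe_insert, Set.mem_insert_iff, Finset.mem_coe] at this
    rcases this with h | h
    · obtain ⟨j, hj⟩ := hsurj y (by simp)
      exact ⟨j, Or.inl ⟨h, hj⟩⟩
    · obtain ⟨j, hj⟩ := hsurj (L.tgt i) (by simp [h])
      exact ⟨j, Or.inr ⟨h, hj⟩⟩
  choose j hj using hτ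
  have hjinj : ∀ i i', j i = j i' → i = i' := by
    intro i i' h
    apply L.tgt_injective
    rcases hj i with ⟨h1, h2⟩ | ⟨h1, h2⟩ <;> rcases hj i' with ⟨h3, h4⟩ | ⟨h3, h4⟩ <;>
      rw [h] at h2
    · rw [h1, h3]
    · exact absurd (h4.symm.trans h2 ▸ h3) hyS
    · exact absurd (h2.symm.trans h4 ▸ h1) hyS
    · exact h2.symm.trans h4
  have hLA : ∀ i, ∀ v ∈ L.carrier i, v = L.tgt i ∨ ∃ a ∈ A, JoinedWithin G' (S : Set V)ᶜ a v := by
    intro i v hv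
    refine (hL i v hv).imp_right fun h => ⟨_, L.src_mem i, h.mono le_rfl ?_⟩
    simp
  have hMB : ∀ i, ∀ v ∈ M.carrier i, v = M.tgt i ∨ ∃ b ∈ B, JoinedWithin G' (S : Set V)ᶜ v b := by
    intro i v hv
    refine (hM i v hv).imp_right fun h => ⟨_, M.src_mem i, h.symm.mono le_rfl ?_⟩
    simp
  -- A common vertex in S is the target of both walks. A common vertex outside S would be joined to
  -- both A and B off S, against the choice of S.
  have hcross : ∀ i i' v, v ∈ L.carrier i → v ∈ M.carrier i' → i' = j i := by
    intro i i' v hv hv'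
    have hjt := hj i
    by_cases hvS : v ∈ S
    · have h1 : v = L.tgt i := (hLA i v hv).resolve_right
        fun ⟨a, _, h⟩ => h.right_mem hvS
      have h2 : v = M.tgt i' := (hMB i' v hv').resolve_right
        fun ⟨a, _, h⟩ => h.left_mem hvS
      apply M.tgt_injective
      rcases hjt with ⟨h3, -⟩ | ⟨-, h3⟩
      · exact absurd (h3 ▸ h1 ▸ hvS) hxS
      · rw [h3, ← h1, ← h2]
    · exfalso
      have h1 : ∃ a ∈ A, JoinedWithin G' (S : Set V)ᶜ a v := by
        rcases hLA i v hv with h | h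
        · rcases hjt with ⟨h3, -⟩ | ⟨h3, -⟩
          · rw [h, h3]; exact hx
          · exact absurd (h ▸ h3) hvS
        · exact h
      have h2 : ∃ b ∈ B, JoinedWithin G' (S : Set V)ᶜ v b := by
        rcases hMB i' v hv' with h | h
        · have := M.tgt_mem i'
          simp only [Finset.coe_insert, Set.mem_insert_iff, Finset.mem_coe] at this
          rcases this with h3 | h3
          · rw [h, h3]; exact hy
          · exact absurd (h ▸ h3) hvS
        · exact h
      obtain ⟨a, ha, h1⟩ := h1
      obtain ⟨b, hb, h2⟩ := h2
      exact hS a ha b hb (h1.trans h2)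
  refine ⟨⟨fun i => L.carrier i ∪ M.carrier (j i), L.src, fun i => M.src (j i), L.src_mem,
    fun i => M.src_mem _, fun i => ?_, ?_⟩⟩
  · have h1 : JoinedWithin G (L.carrier i ∪ M.carrier (j i)) (L.src i) (L.tgt i) :=
      (L.joined i).mono (SimpleGraph.deleteEdges_le _) Set.subset_union_left
    have h2 : JoinedWithin G (L.carrier i ∪ M.carrier (j i)) (M.tgt (j i)) (M.src (j i)) :=
      (M.joined (j i)).symm.mono (SimpleGraph.deleteEdges_le _) Set.subset_union_right
    rcases hj i with ⟨h3, h4⟩ | ⟨-, h4⟩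
    · refine (h1.tail (c := M.tgt (j i)) ?_ h2.left_mem).trans h2
      rw [h3, h4]; exact hadj
    · rw [h4] at h2
      exact h1.trans h2
  · rintro i i' v (h | h) (h' | h')
    · exact L.disj _ _ v h h'
    · exact (hjinj _ _ (hcross i _ v h h')).symm
    · exact hjinj _ _ (hcross i' _ v h' h)
    · exact hjinj _ _ (M.disj _ _ v h h')

/-- **Menger's theorem**, set version. -/
theorem menger [Finite V] (G : SimpleGraph V) (A B : Set V) (k : ℕ)
    (h : NoSmallSeparator G A B k) : Nonempty (Linkage G A B k) := by
  classical
  induction G using WellFoundedLT.induction generalizing A B with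
  | ind G ih =>
  by_cases hG : ∃ x y, G.Adj x y
  · obtain ⟨x, y, hxy⟩ := hG
    set G' := G.deleteEdges {s(x, y)} with hG'
    have hlt : G' < G := by
      refine lt_of_le_of_ne (SimpleGraph.deleteEdges_le _) fun heq => ?_
      have : G'.Adj x y := heq ▸ hxy
      simp [hG', SimpleGraph.deleteEdges_adj] at this
    by_cases h' : NoSmallSeparator G' A B k
    · obtain ⟨L⟩ := ih G' hlt A B h'
      exact ⟨⟨L.carrier, L.src, L.tgt, L.src_mem, L.tgt_mem,
        fun i => (L.joined i).mono hlt.le subset_rfl, L.disj⟩⟩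
    · unfold NoSmallSeparator at h'
      push Not at h'
      obtain ⟨S, hSk, hS⟩ := h'
      have main : ∀ x y, G.Adj x y → G.deleteEdges {s(x, y)} = G' →
          (∃ a ∈ A, JoinedWithin G' (S : Set V)ᶜ a x) →
          (∃ b ∈ B, JoinedWithin G' (S : Set V)ᶜ y b) → Nonempty (Linkage G A B k) := by
        intro x y hxy hxyG hx hy
        have hyx : G.deleteEdges {s(y, x)} = G' := by rw [Sym2.eq_swap, hxyG]
        have hxS : x ∉ S := fun hm => by
          obtain ⟨a, -, hx⟩ := hx
          exact hx.right_mem hm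
        have hyS : y ∉ S := fun hm => by
          obtain ⟨a, -, hx⟩ := hy
          exact hx.left_mem hm
        -- Adding x to S gives a separator of G itself, so S has exactly k - 1 elements. The two
        -- halves from A to S ∪ {x} and from B to S ∪ {y} are then linked by induction.
        have hc := h.le_card_insert (x := x) (y := y) (S := S) (hxyG ▸ hS)
        rw [Finset.card_insert_of_notMem hxS] at hc
        have hS' : ∀ b ∈ B, ∀ a ∈ A, ¬ JoinedWithin G' (S : Set V)ᶜ b a :=
          fun b hb a ha hj => hS a ha b hb hj.symm
        have h1 := h.deleteEdge_half (x := x) (y := y) (S := S) (hxyG ▸ hS) (hxyG ▸ hy)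
        have h2 := h.symm.deleteEdge_half (x := y) (y := x) (S := S) (hyx ▸ hS')
          (by rw [hyx]; exact hx.imp fun a ha => ⟨ha.1, ha.2.symm⟩)
        rw [hxyG] at h1
        rw [hyx] at h2
        obtain ⟨L⟩ := ih G' hlt _ _ h1
        obtain ⟨M⟩ := ih G' hlt _ _ h2
        exact Linkage.glue hxy hxS hyS (by omega) (hxyG ▸ hS) (hxyG ▸ hx) (hxyG ▸ hy)
          (hxyG ▸ L) (hxyG ▸ M)
      obtain ⟨a, ha, b, hb, hab⟩ := h S hSk
      rcases hab.deleteEdge (x := x) (y := y) with h1 | ⟨h1, h2⟩ | ⟨h1, h2⟩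
      · exact absurd h1 (hS a ha b hb)
      · exact main x y hxy rfl ⟨a, ha, h1⟩ ⟨b, hb, h2⟩
      · exact main y x hxy.symm (by rw [Sym2.eq_swap]) ⟨a, ha, h1⟩ ⟨b, hb, h2⟩
  -- In an edgeless graph all walks are constant, so A ∩ B is itself a separator and has at least k
  -- elements.
  · have hjoin : ∀ (U : Set V) a b, JoinedWithin G U a b → a = b := fun U a b hab =>
      hab.induct (P := fun b => a = b) rfl fun u v _ _ hadj _ => absurd ⟨u, v, hadj⟩ hG
    have := Fintype.ofFinite V
    have hk : k ≤ Fintype.card (A ∩ B : Set V) := by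
      by_contra hlt
      obtain ⟨a, ha, b, hb, hab⟩ := h (A ∩ B).toFinset (by rw [Set.toFinset_card]; omega)
      have hm := hab.left_mem
      obtain rfl := hjoin _ _ _ hab
      simp at hm
      exact hm ha hb
    obtain ⟨f⟩ := Function.Embedding.nonempty_of_card_le
      (α := Fin k) (β := (A ∩ B : Set V)) (by simpa using hk)
    refine ⟨⟨fun i => {(f i : V)}, fun i => f i, fun i => f i, fun i => (f i).2.1,
      fun i => (f i).2.2, fun i => .refl rfl, ?_⟩⟩
    rintro i j v hi hj
    simp only [Set.mem_singleton_iff] at hi hj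
    exact f.injective (Subtype.ext (hi.symm.trans hj))

end Menger

/-! ### Fans and linkages inside highly connected vertex sets. -/

/-- The part of `G` induced on `H` stays connected when fewer than `k` vertices are removed. -/
def ConnectedWithin {V : Type*} (G : SimpleGraph V) (H : Set V) (k : ℕ) : Prop :=
  ∀ W : Finset V, W.card < k → ∀ a ∈ H, ∀ b ∈ H, a ∉ W → b ∉ W →
    JoinedWithin G (H \ (W : Set V)) a b

section Fan

variable {V : Type*} {G : SimpleGraph V} {H U : Set V} {k : ℕ} {a b x y z : V}

theorem JoinedWithin.strip_left (h : JoinedWithin G U a b) (hab : b ≠ a) :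
    ∃ u, G.Adj a u ∧ JoinedWithin G (U \ {a}) u b := by
  refine (h.induct (P := fun b => b = a ∨ ∃ u, G.Adj a u ∧ JoinedWithin G (U \ {a}) u b)
    (Or.inl rfl) ?_).resolve_left hab
  intro u v _ ih hadj hv
  by_cases hva : v = a
  · exact Or.inl hva
  rcases ih with rfl | ⟨w, hw, h⟩
  · exact Or.inr ⟨v, hadj, .refl ⟨hv, hva⟩⟩
  · exact Or.inr ⟨w, hw, h.tail hadj ⟨hv, hva⟩⟩

/-- Menger's theorem inside a vertex set `U`. -/
theorem menger_within [Finite V] {A B : Set V} (hA : A ⊆ U)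
    (h : ∀ W : Finset V, W.card < k → ∃ a ∈ A, ∃ b ∈ B, JoinedWithin G (U \ (W : Set V)) a b) :
    ∃ L : Linkage G A B k, ∀ i, L.carrier i ⊆ U := by
  -- Keeping only the edges inside U forces every walk that starts in U to stay there.
  let G' : SimpleGraph V :=
    { Adj := fun u v => G.Adj u v ∧ u ∈ U ∧ v ∈ U
      symm := ⟨fun u v h => ⟨h.1.symm, h.2.2, h.2.1⟩⟩
      loopless := ⟨fun u h => G.loopless.irrefl u h.1⟩ }
  obtain ⟨L⟩ := menger G' A B k (by
    intro W hW
    obtain ⟨a, ha, b, hb, hab⟩ := h W hW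
    refine ⟨a, ha, b, hb, ?_⟩
    refine hab.induct (P := fun b => JoinedWithin G' (W : Set V)ᶜ a b) (.refl hab.left_mem.2) ?_
    intro u v huv ih hadj hv
    exact ih.tail ⟨hadj, huv.right_mem.1, hv.1⟩ hv.2)
  refine ⟨⟨fun i => L.carrier i ∩ U, L.src, L.tgt, L.src_mem, L.tgt_mem, fun i => ?_, ?_⟩,
    fun i => Set.inter_subset_right⟩
  · refine (L.joined i).induct (P := fun b => JoinedWithin G (L.carrier i ∩ U) (L.src i) b)
      (.refl ⟨(L.joined i).left_mem, hA (L.src_mem i)⟩) ?_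
    intro u v _ ih hadj hv
    exact ih.tail hadj.1 ⟨hv, hadj.2.2⟩
  · exact fun i j v hi hj => L.disj i j v hi.1 hj.1

/-- **Fan lemma**: the vertices of `T` are joined to `z` by walks that meet only in `z`. -/
theorem ConnectedWithin.exists_fan [Finite V] (hH : ConnectedWithin G H k) (T : Finset V)
    (hT : ∀ t ∈ T, t ∈ H) (hTk : T.card ≤ k) (hz : z ∈ H) :
    ∃ F : V → Set V, F z = ∅ ∧
      (∀ t ∈ T, t ≠ z → F t ⊆ H \ {z} ∧ ∃ u, JoinedWithin G (F t) t u ∧ G.Adj u z) ∧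
      ∀ t ∈ T, ∀ t' ∈ T, ∀ v, v ∈ F t → v ∈ F t' → t = t' := by
  classical
  obtain ⟨L, hL⟩ := menger_within (G := G) (U := H \ {z}) (A := {u | G.Adj u z} ∩ (H \ {z}))
    (B := (T.erase z : Finset V)) (k := (T.erase z).card) Set.inter_subset_right (by
      intro W hW
      obtain ⟨t, ht, htW⟩ : ∃ t ∈ T.erase z, t ∉ W := by
        by_contra! hcon
        exact absurd (Finset.card_le_card hcon) (by omega)
      have htz := Finset.ne_of_mem_erase ht
      have hle : (T.erase z).card ≤ T.card := Finset.card_erase_le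
      have hWz : (W.erase z).card ≤ W.card := Finset.card_erase_le
      have hj := hH (W.erase z) (by omega) z hz t (hT t (Finset.mem_of_mem_erase ht)) (by simp)
        (fun h => htW (Finset.mem_of_mem_erase h))
      obtain ⟨u, hu, hj⟩ := hj.strip_left htz
      have hj' : JoinedWithin G ((H \ {z}) \ (W : Set V)) u t := hj.mono le_rfl (by
        rintro v ⟨⟨hv, hvW⟩, hvz⟩
        refine ⟨⟨hv, hvz⟩, fun h => hvW ?_⟩
        exact Finset.mem_coe.2 (Finset.mem_erase.2 ⟨hvz, h⟩))
      exact ⟨u, ⟨hu.symm, hj'.left_mem.1⟩, t, ht, hj'⟩)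
  -- The targets are distinct and as many as the elements of T other than z, so each of these is
  -- hit.
  have hsurj : ∀ t ∈ T.erase z, ∃ i, L.tgt i = t := by
    have himg : Finset.univ.image L.tgt = T.erase z := by
      refine Finset.eq_of_subset_of_card_le ?_ ?_
      · intro v hv
        obtain ⟨j, -, rfl⟩ := Finset.mem_image.1 hv
        exact L.tgt_mem j
      · rw [Finset.card_image_of_injective _ L.tgt_injective]
        simp
    intro t ht
    rw [← himg] at ht
    simpa using ht
  refine ⟨fun t => {v | ∃ i, L.tgt i = t ∧ v ∈ L.carrier i}, ?_, ?_, ?_⟩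
  · ext v
    simp only [Set.mem_ofPred_eq, Set.mem_empty_iff_false, iff_false]
    rintro ⟨i, hi, -⟩
    exact Finset.ne_of_mem_erase (L.tgt_mem i) hi
  · intro t ht htz
    obtain ⟨i, rfl⟩ := hsurj t (Finset.mem_erase.2 ⟨htz, ht⟩)
    refine ⟨?_, L.src i, (L.joined i).symm.mono le_rfl fun v hv => ⟨i, rfl, hv⟩, (L.src_mem i).1⟩
    rintro v ⟨j, -, hv⟩
    exact hL j hv
  · rintro _ - _ - v ⟨i, rfl, hi⟩ ⟨j, rfl, hj⟩
    rw [L.disj i j v hi hj]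

/-- Internally disjoint walks between two nonadjacent vertices. -/
theorem ConnectedWithin.exists_linkage_of_not_adj [Finite V] (hH : ConnectedWithin G H k)
    (hx : x ∈ H) (hy : y ∈ H) (hxy : x ≠ y) (hadj : ¬ G.Adj x y) :
    ∃ L : Linkage G {u | G.Adj x u} {v | G.Adj v y} k, ∀ i, L.carrier i ⊆ H \ {x, y} := by
  classical
  obtain ⟨L, hL⟩ := menger_within (G := G) (U := H \ {x, y})
    (A := {u | G.Adj x u} ∩ (H \ {x, y})) (B := {v | G.Adj v y}) (k := k)
    Set.inter_subset_right (by
      intro W hW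
      have hle : (W \ {x, y}).card ≤ W.card := Finset.card_le_card Finset.sdiff_subset
      have hj := hH (W \ {x, y}) (by omega) x hx y hy (by simp) (by simp)
      obtain ⟨u, hu, hj⟩ := hj.strip_left hxy.symm
      obtain ⟨v, hv, hj⟩ := hj.symm.strip_left (a := y) (b := u) (fun h => hadj (h ▸ hu))
      have hj' : JoinedWithin G ((H \ {x, y}) \ (W : Set V)) u v := hj.symm.mono le_rfl (by
        rintro w ⟨⟨⟨hw, hwW⟩, hwx⟩, hwy⟩
        simp only [Set.mem_singleton_iff, Finset.coe_sdiff, Finset.coe_insert,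
          Finset.coe_singleton, Set.mem_sdiff, Set.mem_insert_iff, Finset.mem_coe] at *
        tauto)
      exact ⟨u, ⟨hu, hj'.left_mem.1⟩, v, hv.symm, hj'⟩)
  exact ⟨⟨L.carrier, L.src, L.tgt, fun i => (L.src_mem i).1, L.tgt_mem, L.joined, L.disj⟩, hL⟩

/-- Internally disjoint walks between two adjacent vertices, besides the edge. -/
theorem ConnectedWithin.exists_linkage_of_adj [Finite V] (hH : ConnectedWithin G H (k + 1))
    (S : Finset V) (hSH : ∀ v ∈ S, v ∈ H) (hS : k + 2 ≤ S.card)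
    (hx : x ∈ H) (hy : y ∈ H) (hxy : x ≠ y) :
    ∃ L : Linkage G {u | G.Adj x u} {v | G.Adj v y} k, ∀ i, L.carrier i ⊆ H \ {x, y} := by
  classical
  obtain ⟨L, hL⟩ := menger_within (G := G) (U := H \ {x, y})
    (A := {u | G.Adj x u} ∩ (H \ {x, y})) (B := {v | G.Adj v y}) (k := k)
    Set.inter_subset_right (by
      intro W hW
      -- The edge xy cannot be removed by deleting vertices, so x and y are both joined to a third
      -- vertex w instead. Avoiding W and the other end costs at most k vertices, hence the
      -- hypothesis with k + 1.
      obtain ⟨w, hwS, hw⟩ : ∃ w ∈ S, w ∉ insert x (insert y W) := by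
        by_contra! hcon
        have h1 := Finset.card_le_card hcon
        have h2 := Finset.card_insert_le x (insert y W)
        have h3 := Finset.card_insert_le y W
        omega
      simp only [Finset.mem_insert, not_or] at hw
      obtain ⟨hwx, hwy, hwW⟩ := hw
      have half : ∀ x y : V, x ∈ H → x ≠ y → w ≠ x → w ≠ y →
          ∃ u, G.Adj x u ∧ JoinedWithin G ((H \ {x, y}) \ (W : Set V)) u w := by
        intro x y hx hxy hwx hwy
        have h1 : (insert y (W.erase x)).card < k + 1 := by
          have h2 := Finset.card_insert_le y (W.erase x)
          have h3 : (W.erase x).card ≤ W.card := Finset.card_erase_le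
          omega
        have hj := hH _ h1 x hx w (hSH w hwS) (by simp [hxy]) (by simp [hwy, hwW])
        obtain ⟨u, hu, hj⟩ := hj.strip_left hwx
        refine ⟨u, hu, hj.mono le_rfl ?_⟩
        rintro v ⟨⟨hv, hvW⟩, hvx⟩
        simp only [Set.mem_singleton_iff, Finset.coe_insert, Finset.coe_erase,
          Set.mem_sdiff, Set.mem_insert_iff, Finset.mem_coe] at *
        tauto
      obtain ⟨u, hu, h1⟩ := half x y hx hxy hwx hwy
      obtain ⟨v, hv, h2⟩ := half y x hy hxy.symm hwy hwx
      rw [Set.pair_comm] at h2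
      exact ⟨u, ⟨hu, h1.left_mem.1⟩, v, hv.symm, h1.trans h2.symm⟩)
  exact ⟨⟨L.carrier, L.src, L.tgt, fun i => (L.src_mem i).1, L.tgt_mem, L.joined, L.disj⟩, hL⟩

end Fan

/-! ### Connectivity of a union of two halves. -/

section Doubling

variable {V : Type*} {G : SimpleGraph V} {H₀ H₁ : Set V} {k c : ℕ}

/-- If at least k deleted vertices lie in H₀, fewer than c ≤ k lie elsewhere. So H₁ stays connected,
and every surviving vertex of H₀ keeps a neighbour there. -/
theorem ConnectedWithin.union_of_few [DecidableEq V] (hck : c ≤ k) (hdisj : Disjoint H₀ H₁)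
    (h1 : ConnectedWithin G H₁ k)
    (hn : ∀ v ∈ H₀, ∃ T : Finset V, c ≤ T.card ∧ ∀ t ∈ T, t ∈ H₁ ∧ G.Adj v t)
    (W : Finset V) (hW : W.card < k + c) (W₀ : Finset V) (hW₀ : W₀ ⊆ W) (hW₀' : ∀ v ∈ W₀, v ∈ H₀)
    (hk : k ≤ W₀.card) (a b : V) (ha : a ∈ H₀ ∪ H₁) (hb : b ∈ H₀ ∪ H₁) (haW : a ∉ W)
    (hbW : b ∉ W) : JoinedWithin G ((H₀ ∪ H₁) \ (W : Set V)) a b := by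
  have hfew : (W \ W₀).card < c := by
    have := Finset.card_sdiff_add_card_eq_card hW₀
    omega
  have toH : ∀ v ∈ H₀ ∪ H₁, v ∉ W → ∃ t ∈ H₁, t ∉ W ∧
      JoinedWithin G ((H₀ ∪ H₁) \ (W : Set V)) v t := by
    rintro v (hv | hv) hvW
    · obtain ⟨T, hTc, hT⟩ := hn v hv
      obtain ⟨t, ht, htW⟩ : ∃ t ∈ T, t ∉ W \ W₀ := by
        by_contra! hcon
        exact absurd (Finset.card_le_card hcon) (by omega)
      have htH := (hT t ht).1
      have htW' : t ∉ W := fun h => htW (Finset.mem_sdiff.2 ⟨h, fun h0 =>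
        Set.disjoint_left.1 hdisj (hW₀' t h0) htH⟩)
      exact ⟨t, htH, htW', .of_adj (hT t ht).2 ⟨Or.inl hv, hvW⟩ ⟨Or.inr htH, htW'⟩⟩
    · exact ⟨v, hv, hvW, .refl ⟨Or.inr hv, hvW⟩⟩
  obtain ⟨s, hs, hsW, has⟩ := toH a ha haW
  obtain ⟨t, ht, htW, hbt⟩ := toH b hb hbW
  have hst := h1 (W \ W₀) (by omega) s hs t ht (fun h => hsW (Finset.sdiff_subset h))
    (fun h => htW (Finset.sdiff_subset h))
  refine has.trans ((hst.mono le_rfl ?_).trans hbt.symm)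
  rintro v ⟨hv, hvW⟩
  refine ⟨Or.inr hv, fun h => hvW ?_⟩
  exact Finset.mem_coe.2 (Finset.mem_sdiff.2 ⟨h, fun h0 =>
    Set.disjoint_left.1 hdisj (hW₀' v h0) hv⟩)

/-- Two `k`-connected halves in which every vertex has `c` neighbours in the other half form a
`(k + c)`-connected set. -/
theorem ConnectedWithin.union (hck : c ≤ k) (hdisj : Disjoint H₀ H₁)
    (h0 : ConnectedWithin G H₀ k) (h1 : ConnectedWithin G H₁ k)
    (hn0 : ∀ v ∈ H₀, ∃ T : Finset V, c ≤ T.card ∧ ∀ t ∈ T, t ∈ H₁ ∧ G.Adj v t)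
    (hn1 : ∀ v ∈ H₁, ∃ T : Finset V, c ≤ T.card ∧ ∀ t ∈ T, t ∈ H₀ ∧ G.Adj v t)
    (hm : ∀ W : Finset V, W.card < k + c → ∃ v ∈ H₀, ∃ w ∈ H₁, G.Adj v w ∧ v ∉ W ∧ w ∉ W) :
    ConnectedWithin G (H₀ ∪ H₁) (k + c) := by
  classical
  intro W hW a ha b hb haW hbW
  set W₀ := W.filter (· ∈ H₀) with hW₀
  set W₁ := W.filter (· ∈ H₁) with hW₁
  by_cases hk0 : k ≤ W₀.card
  · exact ConnectedWithin.union_of_few hck hdisj h1 hn0 W hW W₀ (Finset.filter_subset _ _)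
      (fun v hv => (Finset.mem_filter.1 hv).2) hk0 a b ha hb haW hbW
  by_cases hk1 : k ≤ W₁.card
  · rw [Set.union_comm] at ha hb ⊢
    exact ConnectedWithin.union_of_few hck hdisj.symm h0 hn1 W hW W₁ (Finset.filter_subset _ _)
      (fun v hv => (Finset.mem_filter.1 hv).2) hk1 a b ha hb haW hbW
  -- Now both halves lose fewer than k vertices and stay connected; one surviving cross edge joins
  -- them.
  obtain ⟨v, hv, w, hw, hvw, hvW, hwW⟩ := hm W hW
  have j0 : ∀ a ∈ H₀, a ∉ W → JoinedWithin G ((H₀ ∪ H₁) \ (W : Set V)) a v := by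
    intro a ha haW
    refine (h0 W₀ (by omega) a ha v hv (fun h => haW (Finset.mem_filter.1 h).1)
      (fun h => hvW (Finset.mem_filter.1 h).1)).mono le_rfl ?_
    rintro u ⟨hu, huW⟩
    exact ⟨Or.inl hu, fun h => huW (Finset.mem_coe.2 (Finset.mem_filter.2 ⟨h, hu⟩))⟩
  have j1 : ∀ a ∈ H₁, a ∉ W → JoinedWithin G ((H₀ ∪ H₁) \ (W : Set V)) a v := by
    intro a ha haW
    refine JoinedWithin.tail (b := w) ?_ hvw.symm ⟨Or.inl hv, hvW⟩
    refine (h1 W₁ (by omega) a ha w hw (fun h => haW (Finset.mem_filter.1 h).1)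
      (fun h => hwW (Finset.mem_filter.1 h).1)).mono le_rfl ?_
    rintro u ⟨hu, huW⟩
    exact ⟨Or.inr hu, fun h => huW (Finset.mem_coe.2 (Finset.mem_filter.2 ⟨h, hu⟩))⟩
  have j : ∀ a ∈ H₀ ∪ H₁, a ∉ W → JoinedWithin G ((H₀ ∪ H₁) \ (W : Set V)) a v :=
    fun a ha haW => ha.elim (fun h => j0 a h haW) (fun h => j1 a h haW)
  exact (j a ha haW).trans (j b hb hbW).symm

end Doubling

/-! ### Assembling D-paths from segments between vertices of D. -/

section Segments

variable {V : Type*} {G : SimpleGraph V} {D : Finset V} {S T : Set V} {a b c u v : V}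

/-- A path from `a` to `b` with interior in `S`, which may be the edge `ab` only for `S = ∅`. -/
def IsSegment (G : SimpleGraph V) (a b : V) (S : Set V) : Prop :=
  ∃ p : G.Walk a b, p.IsPath ∧ (∀ v ∈ p.support, v = a ∨ v = b ∨ v ∈ S) ∧
    (s(a, b) ∈ p.edges → S = ∅)

theorem IsSegment.symm (h : IsSegment G a b S) : IsSegment G b a S := by
  obtain ⟨p, hp, hs, he⟩ := h
  refine ⟨p.reverse, hp.reverse, fun v hv => ?_, fun h => he ?_⟩
  · have := hs v (by simpa using hv)
    tauto
  · rw [Sym2.eq_swap]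
    simpa using h

theorem IsSegment.of_adj (h : G.Adj a b) : IsSegment G a b ∅ :=
  ⟨h.toWalk, h.isPath_toWalk, by simp, fun _ => rfl⟩

theorem IsSegment.of_joinedWithin (hau : G.Adj a u) (h : JoinedWithin G S u v) (hvb : G.Adj v b)
    (haS : a ∉ S) (hbS : b ∉ S) (hab : a ≠ b) : IsSegment G a b S := by
  obtain ⟨p, hp, hs⟩ := h.exists_isPath
  have hb : b ∉ p.support := fun h => hbS (hs b h)
  have ha : a ∉ (p.concat hvb).support := by
    rw [SimpleGraph.Walk.support_concat]
    simpa using ⟨fun h => haS (hs a h), hab⟩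
  refine ⟨.cons hau (p.concat hvb), (hp.concat hb hvb).cons ha, fun w hw => ?_, fun he => ?_⟩
  · simp only [SimpleGraph.Walk.support_cons, SimpleGraph.Walk.support_concat, List.mem_cons,
      List.mem_append] at hw
    rcases hw with hw | hw | hw
    · exact Or.inl hw
    · exact Or.inr (Or.inr (hs w hw))
    · simp at hw
      exact Or.inr (Or.inl hw)
  · exfalso
    simp only [SimpleGraph.Walk.edges_cons, List.mem_cons] at he
    rcases he with he | he
    · rw [Sym2.eq_iff] at he
      rcases he with ⟨-, rfl⟩ | ⟨rfl, -⟩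
      · exact hbS h.left_mem
      · exact haS h.left_mem
    · exact ha (SimpleGraph.Walk.fst_mem_support_of_mem_edges _ he)

/-- Two segments with a common end combine to a path through the three ends. -/
theorem IsSegment.exists_isDPath [DecidableEq V] (hab : a ≠ b) (hac : a ≠ c) (hbc : b ≠ c)
    (hD : D = {a, b, c}) (h1 : IsSegment G a b S) (h2 : IsSegment G b c T)
    (hS : ∀ v ∈ S, v ∉ D) (hT : ∀ v ∈ T, v ∉ D) (hST : ∀ v ∈ S, v ∉ T) :
    ∃ u w, ∃ p : G.Walk u w, IsDPath G D p ∧ (∀ v ∈ p.support, v ∈ D ∨ v ∈ S ∨ v ∈ T) ∧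
      ∀ e ∈ p.edges, (∀ v ∈ e, v ∈ D) → (e = s(a, b) ∧ S = ∅) ∨ (e = s(b, c) ∧ T = ∅) := by
  subst hD
  simp only [Finset.mem_insert, Finset.mem_singleton, not_or] at hS hT
  obtain ⟨p, hp, hps, hpe⟩ := h1
  obtain ⟨q, hq, hqs, hqe⟩ := h2
  refine ⟨a, c, p.append q, ⟨?_, ?_⟩, ?_, ?_⟩
  · rw [SimpleGraph.Walk.isPath_def, SimpleGraph.Walk.support_append, List.nodup_append]
    refine ⟨hp.support_nodup, hq.support_nodup.tail, fun v hv w hw hvw => ?_⟩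
    subst hvw
    have hvb : v ≠ b := by
      rintro rfl
      have := hq.support_nodup
      rw [← SimpleGraph.Walk.cons_tail_support, List.nodup_cons] at this
      exact this.1 hw
    have h1 := hps v hv
    have h2 := hqs v (List.mem_of_mem_tail hw)
    rcases h1 with rfl | h1 | h1
    · rcases h2 with h2 | h2 | h2
      · exact hvb h2
      · exact hac h2
      · exact (hT _ h2).1 rfl
    · exact hvb h1
    · rcases h2 with h2 | h2 | h2
      · exact hvb h2
      · exact (hS _ h1).2.2 h2
      · exact hST _ h1 h2
  · intro w hw
    simp only [Finset.mem_insert, Finset.mem_singleton] at hw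
    rw [SimpleGraph.Walk.mem_support_append_iff]
    rcases hw with rfl | rfl | rfl <;> simp
  · intro v hv
    rw [SimpleGraph.Walk.mem_support_append_iff] at hv
    simp only [Finset.mem_insert, Finset.mem_singleton]
    rcases hv with hv | hv
    · have := hps v hv; tauto
    · have := hqs v hv; tauto
  · intro e he heD
    induction e with
    | _ v w =>
    have hv := heD v (by simp)
    have hw := heD w (by simp)
    simp only [Finset.mem_insert, Finset.mem_singleton] at hv hw
    rw [SimpleGraph.Walk.edges_append, List.mem_append] at he
    rcases he with he | he
    · left
      have hadj := SimpleGraph.Walk.adj_of_mem_edges _ he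
      have h1 : ∀ v ∈ p.support, (v = a ∨ v = b ∨ v = c) → v = a ∨ v = b := by
        rintro v hv hvD
        rcases hps v hv with h | h | h
        · exact Or.inl h
        · exact Or.inr h
        · have := hS v h; tauto
      have h2 := h1 v (SimpleGraph.Walk.fst_mem_support_of_mem_edges _ he) hv
      have h3 := h1 w (SimpleGraph.Walk.snd_mem_support_of_mem_edges _ he) hw
      have h4 : s(v, w) = s(a, b) := by
        have := hadj.ne
        rcases h2 with rfl | rfl <;> rcases h3 with rfl | rfl <;> simp_all
      exact ⟨h4, hpe (h4 ▸ he)⟩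
    · right
      have hadj := SimpleGraph.Walk.adj_of_mem_edges _ he
      have h1 : ∀ v ∈ q.support, (v = a ∨ v = b ∨ v = c) → v = b ∨ v = c := by
        rintro v hv hvD
        rcases hqs v hv with h | h | h
        · exact Or.inl h
        · exact Or.inr h
        · have := hT v h; tauto
      have h2 := h1 v (SimpleGraph.Walk.fst_mem_support_of_mem_edges _ he) hv
      have h3 := h1 w (SimpleGraph.Walk.snd_mem_support_of_mem_edges _ he) hw
      have h4 : s(v, w) = s(b, c) := by
        have := hadj.ne
        rcases h2 with rfl | rfl <;> rcases h3 with rfl | rfl <;> simp_all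
      exact ⟨h4, hqe (h4 ▸ he)⟩

/-- Paths through `D` that are assembled from the members of a disjoint family of segments, each
used once, are internally disjoint. -/
theorem hasDisjointDPaths_of_labels {ι : Type*} {m : ℕ} (F : ι → Set V) (E : ι → Sym2 V)
    (l₀ l₁ : Fin m → ι) (hF : ∀ l l' v, v ∈ F l → v ∈ F l' → l = l')
    (hE : ∀ l l', F l = ∅ → F l' = ∅ → E l = E l' → l = l')
    (h0 : Function.Injective l₀) (h1 : Function.Injective l₁) (h01 : ∀ i j, l₀ i ≠ l₁ j)
    (h : ∀ i, ∃ u w, ∃ p : G.Walk u w, IsDPath G D p ∧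
      (∀ v ∈ p.support, v ∈ D ∨ v ∈ F (l₀ i) ∨ v ∈ F (l₁ i)) ∧
      ∀ e ∈ p.edges, (∀ v ∈ e, v ∈ D) →
        (e = E (l₀ i) ∧ F (l₀ i) = ∅) ∨ (e = E (l₁ i) ∧ F (l₁ i) = ∅)) :
    HasDisjointDPaths G D m := by
  choose s t P hP hs he using h
  have key : ∀ i j, i ≠ j → ∀ v, v ∈ (P i).support → v ∈ (P j).support → v ∈ D := by
    intro i j hij v hi hj
    rcases hs i v hi with h | h | h
    · exact h
    all_goals
      rcases hs j v hj with h' | h' | h'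
      · exact h'
      all_goals
        have := hF _ _ v h h'
        first
          | exact absurd (h0 this) hij
          | exact absurd (h1 this) hij
          | exact absurd this (h01 _ _)
          | exact absurd this.symm (h01 _ _)
  refine ⟨s, t, P, hP, fun i j hij => ⟨?_, ?_⟩⟩
  · ext v
    exact ⟨fun hv => key i j hij v hv.1 hv.2, fun hv => ⟨(hP i).2 v hv, (hP j).2 v hv⟩⟩
  · rw [Set.eq_empty_iff_forall_notMem]
    rintro e ⟨hi, hj⟩
    -- A shared edge has both ends in D, so in either path it is a whole segment with empty
    -- interior. Such a segment is determined by its edge and is used only once.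
    have heD : ∀ v ∈ e, v ∈ D := fun v hv =>
      key i j hij v (SimpleGraph.Walk.mem_support_of_mem_edges hi hv)
        (SimpleGraph.Walk.mem_support_of_mem_edges hj hv)
    rcases he i e hi heD with ⟨h, hf⟩ | ⟨h, hf⟩ <;>
      rcases he j e hj heD with ⟨h', hf'⟩ | ⟨h', hf'⟩ <;>
      have := hE _ _ hf hf' (h.symm.trans h')
    · exact hij (h0 this)
    · exact h01 _ _ this
    · exact h01 _ _ this.symm
    · exact hij (h1 this)

/-- A disjoint family of `2k` segments `xy`, `2k - 1` segments `xz` and `2k - 1` segments `yz`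
yields `3k - 1` internally disjoint paths. -/
theorem hasDisjointDPaths_of_segments [DecidableEq V] {x y z : V} {k : ℕ} (hk : 0 < k)
    (hxy : x ≠ y) (hxz : x ≠ z) (hyz : y ≠ z)
    (F : Fin (2 * k) ⊕ Fin (2 * k - 1) ⊕ Fin (2 * k - 1) → Set V)
    (hF : ∀ l l' v, v ∈ F l → v ∈ F l' → l = l')
    (hD : ∀ l, ∀ v ∈ F l, v ∉ ({x, y, z} : Finset V))
    (hxyS : ∀ i, IsSegment G x y (F (Sum.inl i)))
    (hxzS : ∀ i, IsSegment G x z (F (Sum.inr (Sum.inl i))))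
    (hyzS : ∀ i, IsSegment G y z (F (Sum.inr (Sum.inr i))))
    (hxyE : ∀ i j, F (Sum.inl i) = ∅ → F (Sum.inl j) = ∅ → i = j)
    (hxzE : ∀ i j, F (Sum.inr (Sum.inl i)) = ∅ → F (Sum.inr (Sum.inl j)) = ∅ → i = j)
    (hyzE : ∀ i j, F (Sum.inr (Sum.inr i)) = ∅ → F (Sum.inr (Sum.inr j)) = ∅ → i = j) :
    HasDisjointDPaths G {x, y, z} (3 * k - 1) := by
  let E : Fin (2 * k) ⊕ Fin (2 * k - 1) ⊕ Fin (2 * k - 1) → Sym2 V :=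
    Sum.elim (fun _ => s(x, y)) (Sum.elim (fun _ => s(x, z)) (fun _ => s(y, z)))
  -- The middle vertex is x for the first k paths (xy with xz), y for the next k (xy with yz), and z
  -- for the last k - 1 (xz with yz). This uses up all 2k + 2(2k - 1) segments.
  let l₀ : Fin (3 * k - 1) → Fin (2 * k) ⊕ Fin (2 * k - 1) ⊕ Fin (2 * k - 1) := fun i =>
    if h : i.val < 2 * k then Sum.inl ⟨i, h⟩ else Sum.inr (Sum.inl ⟨i - k, by omega⟩)
  let l₁ : Fin (3 * k - 1) → Fin (2 * k) ⊕ Fin (2 * k - 1) ⊕ Fin (2 * k - 1) := fun i =>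
    if h : i.val < k then Sum.inr (Sum.inl ⟨i, by omega⟩)
    else Sum.inr (Sum.inr ⟨i - k, by omega⟩)
  have hdis : ∀ l l', l ≠ l' → ∀ v ∈ F l, v ∉ F l' := fun l l' hl v h h' => hl (hF l l' v h h')
  refine hasDisjointDPaths_of_labels F E l₀ l₁ hF ?_ ?_ ?_ ?_ ?_
  · have h1 : s(x, y) ≠ s(x, z) := by simp [hyz, hxz]
    have h2 : s(x, y) ≠ s(y, z) := by simp [hxy, hxz]
    have h3 : s(x, z) ≠ s(y, z) := by simp [hxy, hxz]
    rintro (i | i | i) (j | j | j) hi hj hij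
    · rw [hxyE i j hi hj]
    · exact absurd hij h1
    · exact absurd hij h2
    · exact absurd hij h1.symm
    · rw [hxzE i j hi hj]
    · exact absurd hij h3
    · exact absurd hij h2.symm
    · exact absurd hij h3.symm
    · rw [hyzE i j hi hj]
  · intro i j hij
    simp only [l₀] at hij
    split_ifs at hij <;> simp at hij <;> omega
  · intro i j hij
    simp only [l₁] at hij
    split_ifs at hij <;> simp at hij <;> omega
  · intro i j hij
    simp only [l₀, l₁] at hij
    split_ifs at hij <;> simp at hij
    omega
  · intro i
    by_cases h1 : i.val < k
    · have e0 : l₀ i = Sum.inl ⟨i, by omega⟩ := dif_pos (by omega)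
      have e1 : l₁ i = Sum.inr (Sum.inl ⟨i, by omega⟩) := dif_pos h1
      rw [e0, e1]
      have hE0 : E (Sum.inl ⟨i, by omega⟩) = s(y, x) := Sym2.eq_swap
      rw [hE0]
      exact (hxyS _).symm.exists_isDPath hxy.symm hyz hxz (by rw [Finset.insert_comm])
        (hxzS _) (hD _) (hD _) (hdis _ _ (by simp))
    · have e1 : l₁ i = Sum.inr (Sum.inr ⟨i - k, by omega⟩) := dif_neg h1
      by_cases h2 : i.val < 2 * k
      · have e0 : l₀ i = Sum.inl ⟨i, h2⟩ := dif_pos h2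
        rw [e0, e1]
        exact (hxyS _).exists_isDPath hxy hxz hyz rfl (hyzS _) (hD _) (hD _) (hdis _ _ (by simp))
      · have e0 : l₀ i = Sum.inr (Sum.inl ⟨i - k, by omega⟩) := dif_neg h2
        rw [e0, e1]
        have hE1 : E (Sum.inr (Sum.inr ⟨i - k, by omega⟩)) = s(z, y) := Sym2.eq_swap
        rw [hE1]
        exact (hxzS _).exists_isDPath hxz hxy hyz.symm (by rw [Finset.pair_comm])
          (hyzS _).symm (hD _) (hD _) (hdis _ _ (by simp))

end Segments

/-! ### Paths through three vertices split between two highly connected halves. -/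

section Bundle

variable {V : Type*} {G : SimpleGraph V} {H H₀ H₁ : Set V} {q : ℕ} {x y z : V}

/-- A family of `2q + 2` disjoint segments from `x` to `y` inside `H`, of which `q` selected ones
have distinct first and last interior vertices. -/
structure SegmentBundle {V : Type*} (G : SimpleGraph V) (H : Set V) (x y : V) (q : ℕ) where
  carrier : Fin (2 * q + 2) → Set V
  fst : Fin (2 * q + 2) → V
  lst : Fin (2 * q + 2) → V
  long : Finset (Fin (2 * q + 2))
  card_long : long.card = q
  subset : ∀ j, carrier j ⊆ H \ {x, y}
  disj : ∀ i j v, v ∈ carrier i → v ∈ carrier j → i = j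
  segment : ∀ j, IsSegment G x y (carrier j)
  empty : ∀ i j, carrier i = ∅ → carrier j = ∅ → i = j
  fst_mem : ∀ j ∈ long, fst j ∈ carrier j
  lst_mem : ∀ j ∈ long, lst j ∈ carrier j
  fst_ne_lst : ∀ j ∈ long, fst j ≠ lst j
  adj_fst : ∀ j ∈ long, G.Adj x (fst j)
  lst_adj : ∀ j ∈ long, G.Adj (lst j) y

/-- A member with equal source and target passes through a vertex of A ∩ B, and distinct members
give distinct ones. So at most s members are short. -/
theorem Linkage.exists_long [DecidableEq V] {A B : Set V} {k q s : ℕ} (L : Linkage G A B k)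
    (hs : ∀ C : Finset V, (∀ c ∈ C, ∃ j, c ∈ L.carrier j ∧ c ∈ A ∧ c ∈ B) → C.card ≤ s)
    (hk : q + s ≤ k) :
    ∃ R : Finset (Fin k), R.card = q ∧ ∀ j ∈ R, L.src j ≠ L.tgt j := by
  have h1 := hs ((Finset.univ.filter fun j => L.src j = L.tgt j).image L.src) (by
    intro c hc
    obtain ⟨j, hj, rfl⟩ := Finset.mem_image.1 hc
    refine ⟨j, (L.joined j).left_mem, L.src_mem j, ?_⟩
    rw [(Finset.mem_filter.1 hj).2]
    exact L.tgt_mem j)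
  rw [Finset.card_image_of_injective _ L.src_injective] at h1
  have h2 := Finset.card_filter_add_card_filter_not (s := Finset.univ)
    (fun j => L.src j = L.tgt j)
  rw [Finset.card_univ, Fintype.card_fin] at h2
  obtain ⟨R, hR, hRq⟩ := Finset.exists_subset_card_eq
    (s := Finset.univ.filter fun j => ¬ L.src j = L.tgt j) (n := q) (by omega)
  exact ⟨R, hRq, fun j hj => (Finset.mem_filter.1 (hR hj)).2⟩

/-- Segments that cannot be cut are the edge xy and those through one common neighbour. When q > 0
there are at most q + 2 of them among the 2q + 2, so q others remain. -/
theorem ConnectedWithin.exists_segmentBundle [Finite V] (hH : ConnectedWithin G H (2 * q + 2))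
    (S : Finset V) (hSH : ∀ v ∈ S, v ∈ H) (hS : 2 * q + 3 ≤ S.card)
    (hx : x ∈ H) (hy : y ∈ H) (hxy : x ≠ y)
    (hshort : q = 0 ∨ ∀ C : Finset V, (∀ c ∈ C, c ∈ H ∧ G.Adj x c ∧ G.Adj c y) →
      C.card ≤ q + 2 ∧ (G.Adj x y → C.card + 1 ≤ q + 2)) :
    Nonempty (SegmentBundle G H x y q) := by
  classical
  by_cases hadj : G.Adj x y
  · obtain ⟨L, hL⟩ := ConnectedWithin.exists_linkage_of_adj (k := 2 * q + 1) hH S hSH hS hx hy hxy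
    obtain ⟨R, hR, hRne⟩ : ∃ R : Finset (Fin (2 * q + 1)), R.card = q ∧
        ∀ j ∈ R, L.src j ≠ L.tgt j := by
      rcases hshort with rfl | hshort
      · exact ⟨∅, by simp⟩
      · refine L.exists_long (s := q + 1) (fun C hC => ?_) (by omega)
        have := (hshort C (fun c hc => by
          obtain ⟨j, hj, h1, h2⟩ := hC c hc
          exact ⟨(hL j hj).1, h1, h2⟩)).2 hadj
        omega
    -- The edge xy becomes segment 0, with empty interior. Its end vertices are dummies: index 0 is
    -- never selected, since the selected set is shifted by one.
    refine ⟨⟨Fin.cons ∅ L.carrier, Fin.cons x L.src, Fin.cons x L.tgt,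
      R.map (Fin.succEmb _), by simpa using hR, ?_, ?_, ?_, ?_, ?_, ?_, ?_, ?_, ?_⟩⟩
    · exact Fin.cases (by simp) (fun j => by simpa using hL j)
    · refine Fin.cases (by simp) fun i => Fin.cases (by simp) fun j => ?_
      intro v hi hj
      simp only [Fin.cons_succ] at hi hj
      rw [L.disj i j v hi hj]
    · refine Fin.cases (by simpa using IsSegment.of_adj hadj) fun j => ?_
      simp only [Fin.cons_succ]
      exact .of_joinedWithin (L.src_mem j) (L.joined j) (L.tgt_mem j)
        (fun h => (hL j h).2 (by simp)) (fun h => (hL j h).2 (by simp)) hxy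
    · have hne : ∀ j, L.carrier j ≠ ∅ := fun j h => by
        have := (L.joined j).left_mem
        simp [h] at this
      exact Fin.cases (fun j => Fin.cases (fun _ _ => rfl) (fun j _ h => absurd h (hne j)) j)
        (fun i j h => absurd h (hne i))
    all_goals
      intro j hj
      obtain ⟨i, hi, rfl⟩ := Finset.mem_map.1 hj
      simp only [Fin.coe_succEmb, Fin.cons_succ]
    · exact (L.joined i).left_mem
    · exact (L.joined i).right_mem
    · exact hRne i hi
    · exact L.src_mem i
    · exact L.tgt_mem i
  · obtain ⟨L, hL⟩ := ConnectedWithin.exists_linkage_of_not_adj hH hx hy hxy hadj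
    obtain ⟨R, hR, hRne⟩ : ∃ R : Finset (Fin (2 * q + 2)), R.card = q ∧
        ∀ j ∈ R, L.src j ≠ L.tgt j := by
      rcases hshort with rfl | hshort
      · exact ⟨∅, by simp⟩
      · refine L.exists_long (s := q + 2) (fun C hC => ?_) (by omega)
        exact (hshort C (fun c hc => by
          obtain ⟨j, hj, h1, h2⟩ := hC c hc
          exact ⟨(hL j hj).1, h1, h2⟩)).1
    refine ⟨⟨L.carrier, L.src, L.tgt, R, hR, hL, L.disj, fun j => ?_, fun i j h => ?_,
      fun j _ => (L.joined j).left_mem, fun j _ => (L.joined j).right_mem, hRne,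
      fun j _ => L.src_mem j, fun j _ => L.tgt_mem j⟩⟩
    · exact .of_joinedWithin (L.src_mem j) (L.joined j) (L.tgt_mem j)
        (fun h => (hL j h).2 (by simp)) (fun h => (hL j h).2 (by simp)) hxy
    · have := (L.joined i).left_mem
      simp [h] at this

/-- If `x, y` lie in one highly connected half and `z` in the other one, and few short paths join
`x` to `y`, then many internally disjoint paths contain `x`, `y` and `z`. -/
theorem hasDisjointDPaths_of_halves [Finite V] [DecidableEq V] {k : ℕ} (hqk : q + 2 = 2 * k)
    (hdisj : Disjoint H₀ H₁)
    (h0 : ConnectedWithin G H₀ (2 * q + 2)) (h1 : ConnectedWithin G H₁ (2 * q + 2))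
    (φ : V → V) (hφ : ∀ v ∈ H₀, φ v ∈ H₁ ∧ G.Adj v (φ v)) (hinj : Function.Injective φ)
    (S : Finset V) (hSH : ∀ v ∈ S, v ∈ H₀) (hS : 2 * q + 3 ≤ S.card)
    (hx : x ∈ H₀) (hy : y ∈ H₀) (hz : z ∈ H₁) (hxy : x ≠ y)
    (hshort : q = 0 ∨ ∀ C : Finset V, (∀ c ∈ C, c ∈ H₀ ∧ G.Adj x c ∧ G.Adj c y) →
      C.card ≤ q + 2 ∧ (G.Adj x y → C.card + 1 ≤ q + 2)) :
    HasDisjointDPaths G {x, y, z} (3 * k - 1) := by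
  obtain ⟨B⟩ := h0.exists_segmentBundle S hSH hS hx hy hxy hshort
  have hne01 : ∀ u ∈ H₀, ∀ v ∈ H₁, u ≠ v := fun u hu v hv h =>
    Set.disjoint_left.1 hdisj hu (h ▸ hv)
  have hBH : ∀ j v, v ∈ B.carrier j → v ∈ H₀ ∧ v ≠ x ∧ v ≠ y := fun j v hv => by
    have := B.subset j hv
    simpa [not_or] using this
  -- the starting points of the walks that cross over to the other half
  let w : Option B.long ⊕ Option B.long → V :=
    Sum.elim (fun o => o.elim x fun j => B.fst j) (fun o => o.elim y fun j => B.lst j)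
  have hwH : ∀ l, w l ∈ H₀ := by
    rintro ((_ | j) | (_ | j))
    · exact hx
    · exact (hBH j _ (B.fst_mem j j.2)).1
    · exact hy
    · exact (hBH j _ (B.lst_mem j j.2)).1
  have hwinj : ∀ l l', w l = w l' → l = l' := by
    have e1 := fun j : B.long => hBH j _ (B.fst_mem j j.2)
    have e2 := fun j : B.long => hBH j _ (B.lst_mem j j.2)
    have e3 : ∀ i j : B.long, B.fst i ≠ B.lst j := by
      intro i j h
      have := B.disj i j (B.fst i) (B.fst_mem i i.2) (h ▸ B.lst_mem j j.2)
      exact B.fst_ne_lst i i.2 (by rw [this] at h ⊢; exact h)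
    have e4 : ∀ i j : B.long, B.fst i = B.fst j → i = j := fun i j h =>
      Subtype.ext (B.disj i j (B.fst i) (B.fst_mem i i.2) (h ▸ B.fst_mem j j.2))
    have e5 : ∀ i j : B.long, B.lst i = B.lst j → i = j := fun i j h =>
      Subtype.ext (B.disj i j (B.lst i) (B.lst_mem i i.2) (h ▸ B.lst_mem j j.2))
    rintro ((_ | i) | (_ | i)) ((_ | j) | (_ | j)) h <;>
      simp only [w, Sum.elim_inl, Sum.elim_inr, Option.elim_none, Option.elim_some] at h
    · rfl
    · exact absurd h.symm (e1 j).2.1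
    · exact absurd h hxy
    · exact absurd h.symm (e2 j).2.1
    · exact absurd h (e1 i).2.1
    · rw [e4 i j h]
    · exact absurd h (e1 i).2.2
    · exact absurd h (e3 i j)
    · exact absurd h.symm hxy
    · exact absurd h.symm (e1 j).2.2
    · rfl
    · exact absurd h.symm (e2 j).2.2
    · exact absurd h (e2 i).2.1
    · exact absurd h.symm (e3 j i)
    · exact absurd h (e2 i).2.2
    · rw [e5 i j h]
  -- There are 2(q + 1) crossing points: x, y and the two ends of each of the q long segments. This
  -- equals the connectivity of the second half.
  obtain ⟨F, hFz, hF, hFd⟩ := h1.exists_fan (Finset.univ.image fun l => φ (w l))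
    (by
      intro t ht
      obtain ⟨l, -, rfl⟩ := Finset.mem_image.1 ht
      exact (hφ _ (hwH l)).1)
    (by
      refine Finset.card_image_le.trans ?_
      simp [B.card_long]
      omega) hz
  have hT : ∀ l, φ (w l) ∈ Finset.univ.image fun l => φ (w l) := fun l =>
    Finset.mem_image_of_mem _ (Finset.mem_univ l)
  have hFsub : ∀ l v, v ∈ F (φ (w l)) → v ∈ H₁ ∧ v ≠ z := by
    intro l v hv
    by_cases hlz : φ (w l) = z
    · rw [hlz, hFz] at hv
      exact absurd hv (Set.notMem_empty v)
    · simpa using (hF _ (hT l) hlz).1 hv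
  have hFdis : ∀ l l' v, v ∈ F (φ (w l)) → v ∈ F (φ (w l')) → l = l' := fun l l' v h h' =>
    hwinj _ _ (hinj (hFd _ (hT l) _ (hT l') v h h'))
  -- the parts in the first half
  let A : Option B.long ⊕ Option B.long → Set V :=
    Sum.elim (fun o => o.elim ∅ fun j => {B.fst j}) (fun o => o.elim ∅ fun j => {B.lst j})
  have hA : ∀ l v, v ∈ A l → v = w l ∧ ∃ j : B.long, v ∈ B.carrier j := by
    rintro ((_ | j) | (_ | j)) v hv
    · exact absurd hv (Set.notMem_empty v)
    · obtain rfl : v = B.fst j := hv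
      exact ⟨rfl, j, B.fst_mem j j.2⟩
    · exact absurd hv (Set.notMem_empty v)
    · obtain rfl : v = B.lst j := hv
      exact ⟨rfl, j, B.lst_mem j j.2⟩
  -- Unselected segments still join x to y. A selected one is replaced by two segments to z,
  -- starting with its first and its last vertex; the index `none` stands for crossing straight from
  -- x or y.
  let P : {j // j ∉ B.long} ⊕ (Option B.long ⊕ Option B.long) → Set V :=
    Sum.elim (fun j => B.carrier j) (fun l => A l ∪ F (φ (w l)))
  have hP : ∀ l l' v, v ∈ P l → v ∈ P l' → l = l' := by
    have hx1 : ∀ (j : {j // j ∉ B.long}) l v, v ∈ B.carrier j → v ∉ A l ∪ F (φ (w l)) := by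
      rintro j l v hv (h | h)
      · obtain ⟨-, i, hi⟩ := hA l v h
        exact j.2 (B.disj i j v hi hv ▸ i.2)
      · exact hne01 v (hBH j v hv).1 v (hFsub l v h).1 rfl
    rintro (i | l) (j | l') v hv hv'
    · exact congrArg Sum.inl (Subtype.ext (B.disj i j v hv hv'))
    · exact absurd hv' (hx1 i l' v hv)
    · exact absurd hv (hx1 j l v hv')
    · refine congrArg Sum.inr ?_
      rcases hv with hv | hv <;> rcases hv' with hv' | hv'
      · exact hwinj _ _ ((hA l v hv).1.symm.trans (hA l' v hv').1)
      · obtain ⟨-, i, hi⟩ := hA l v hv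
        exact absurd rfl (hne01 v (hBH i v hi).1 v (hFsub l' v hv').1)
      · obtain ⟨-, i, hi⟩ := hA l' v hv'
        exact absurd rfl (hne01 v (hBH i v hi).1 v (hFsub l v hv).1)
      · exact hFdis l l' v hv hv'
  have hPD : ∀ l, ∀ v ∈ P l, v ≠ x ∧ v ≠ y ∧ v ≠ z := by
    have hc : ∀ j v, v ∈ B.carrier j → v ≠ x ∧ v ≠ y ∧ v ≠ z := fun j v hv =>
      ⟨(hBH j v hv).2.1, (hBH j v hv).2.2, hne01 v (hBH j v hv).1 z hz⟩
    rintro (j | l) v hv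
    · exact hc j v hv
    · rcases hv with hv | hv
      · obtain ⟨-, i, hi⟩ := hA l v hv
        exact hc i v hi
      · exact ⟨(hne01 x hx v (hFsub l v hv).1).symm, (hne01 y hy v (hFsub l v hv).1).symm,
          (hFsub l v hv).2⟩
  -- segments that cross over directly
  have hdirect : ∀ l, IsSegment G (w l) z (F (φ (w l))) := by
    intro l
    have hadj := (hφ _ (hwH l)).2
    by_cases hlz : φ (w l) = z
    · rw [hlz, hFz]
      exact .of_adj (hlz ▸ hadj)
    · obtain ⟨-, u, hu, huz⟩ := hF _ (hT l) hlz
      exact .of_joinedWithin hadj hu huz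
        (fun h => hne01 _ (hwH l) _ (hFsub l _ h).1 rfl) (fun h => (hFsub l _ h).2 rfl)
        (hne01 _ (hwH l) _ hz)
  have hlong : ∀ l a, G.Adj a (w l) → a ∈ H₀ → A l = {w l} →
      IsSegment G a z (A l ∪ F (φ (w l))) := by
    intro l a haw ha hAl
    have hadj := (hφ _ (hwH l)).2
    have ha' : a ∉ A l ∪ F (φ (w l)) := by
      rintro (h | h)
      · rw [hAl] at h
        obtain rfl : a = w l := h
        exact G.loopless.irrefl _ haw
      · exact hne01 a ha a (hFsub l a h).1 rfl
    have hz' : z ∉ A l ∪ F (φ (w l)) := fun h => (hPD (Sum.inr l) z h).2.2 rfl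
    have hw : w l ∈ A l ∪ F (φ (w l)) := Or.inl (by rw [hAl]; rfl)
    by_cases hlz : φ (w l) = z
    · exact .of_joinedWithin haw (.refl hw) (hlz ▸ hadj) ha' hz' (hne01 _ ha _ hz)
    · obtain ⟨-, u, hu, huz⟩ := hF _ (hT l) hlz
      have hu' := hu.mono (U' := A l ∪ F (φ (w l))) le_rfl Set.subset_union_right
      exact .of_joinedWithin haw ((JoinedWithin.of_adj hadj hw hu'.left_mem).trans hu') huz
        ha' hz' (hne01 _ ha _ hz)
  have hsx : ∀ o, IsSegment G x z (P (Sum.inr (Sum.inl o))) := by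
    rintro (_ | j)
    · have : P (Sum.inr (Sum.inl none)) = F (φ x) := Set.empty_union _
      rw [this]
      exact hdirect (Sum.inl none)
    · exact hlong (Sum.inl (some j)) x (B.adj_fst j j.2) hx rfl
  have hsy : ∀ o, IsSegment G y z (P (Sum.inr (Sum.inr o))) := by
    rintro (_ | j)
    · have : P (Sum.inr (Sum.inr none)) = F (φ y) := Set.empty_union _
      rw [this]
      exact hdirect (Sum.inr none)
    · exact hlong (Sum.inr (some j)) y (B.lst_adj j j.2).symm hy rfl
  have hex : ∀ o, P (Sum.inr (Sum.inl o)) = ∅ → o = none := by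
    rintro (_ | j) h
    · rfl
    · exact absurd h (Set.Nonempty.ne_empty ⟨B.fst j, Or.inl rfl⟩)
  have hey : ∀ o, P (Sum.inr (Sum.inr o)) = ∅ → o = none := by
    rintro (_ | j) h
    · rfl
    · exact absurd h (Set.Nonempty.ne_empty ⟨B.lst j, Or.inl rfl⟩)
  have c1 : Fintype.card {j // j ∉ B.long} = 2 * k := by
    rw [Fintype.card_subtype_compl]
    simp [B.card_long]
    omega
  have c2 : Fintype.card (Option B.long) = 2 * k - 1 := by
    simp [B.card_long]
    omega
  let e1 : Fin (2 * k) ≃ {j // j ∉ B.long} := (Fintype.equivFinOfCardEq c1).symm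
  let e2 : Fin (2 * k - 1) ≃ Option B.long := (Fintype.equivFinOfCardEq c2).symm
  let e := Equiv.sumCongr e1 (Equiv.sumCongr e2 e2)
  refine hasDisjointDPaths_of_segments (by omega) hxy (hne01 x hx z hz) (hne01 y hy z hz)
    (fun l => P (e l)) (fun l l' v h h' => e.injective (hP _ _ v h h')) ?_
    (fun i => B.segment _) (fun i => hsx _) (fun i => hsy _) ?_ ?_ ?_
  · intro l v hv
    have := hPD _ v hv
    simpa [not_or] using this
  · exact fun i j hi hj => e1.injective (Subtype.ext (B.empty _ _ hi hj))
  · exact fun i j hi hj => e2.injective ((hex _ hi).trans (hex _ hj).symm)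
  · exact fun i j hi hj => e2.injective ((hey _ hi).trans (hey _ hj).symm)

end Bundle

/-! ### The flip graph and the connectivity of its subcubes. -/

section FlipGraph

variable {N : ℕ}

/-- The `m`-th unit vector, which is `0` for `m ≥ N`. -/
def unitVec (N m : ℕ) : Fin N → ZMod 2 := fun j => if (j : ℕ) = m then 1 else 0

/-- The vectors with one nonzero entry or two consecutive ones. -/
def IsFlip (d : Fin N → ZMod 2) : Prop :=
  ∃ m < N, d = unitVec N m ∨ d = unitVec N m + unitVec N (m + 1)

instance (d : Fin N → ZMod 2) : Decidable (IsFlip d) := by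
  unfold IsFlip; infer_instance

theorem vec_add_self (x : Fin N → ZMod 2) : x + x = 0 :=
  funext fun j => CharTwo.add_self_eq_zero (x j)

theorem vec_add_cancel (x y : Fin N → ZMod 2) : x + (x + y) = y := by
  rw [← add_assoc, vec_add_self, zero_add]

theorem vec_eq_of_add_eq {x y d : Fin N → ZMod 2} (h : x + y = d) : y = x + d := by
  rw [← h, vec_add_cancel]

theorem unitVec_self {m : ℕ} (h : m < N) : unitVec N m ⟨m, h⟩ = 1 := by simp [unitVec]

theorem unitVec_of_ne {m : ℕ} {j : Fin N} (h : (j : ℕ) ≠ m) : unitVec N m j = 0 := by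
  simp [unitVec, h]

theorem unitVec_of_le {m : ℕ} (h : N ≤ m) : unitVec N m = 0 := by
  funext j
  exact unitVec_of_ne (by omega)

theorem not_isFlip_zero : ¬ IsFlip (0 : Fin N → ZMod 2) := by
  rintro ⟨m, hm, h | h⟩ <;> have := congrFun h ⟨m, hm⟩ <;> simp [unitVec] at this

theorem IsFlip.cases_of_ne_zero {s : Fin N → ZMod 2} (hs : IsFlip s) {p : Fin N} (hp : s p ≠ 0) :
    s = unitVec N p ∨ s = unitVec N p + unitVec N (p + 1) ∨
      ∃ m, m + 1 = (p : ℕ) ∧ s = unitVec N m + unitVec N p := by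
  obtain ⟨m, hm, rfl | rfl⟩ := hs
  · by_cases h : (p : ℕ) = m
    · exact Or.inl (by rw [h])
    · exact absurd (unitVec_of_ne h) hp
  · by_cases h : (p : ℕ) = m
    · exact Or.inr (Or.inl (by rw [h]))
    · by_cases h' : (p : ℕ) = m + 1
      · exact Or.inr (Or.inr ⟨m, h'.symm, by rw [h']⟩)
      · exact absurd (by simp [unitVec_of_ne h, unitVec_of_ne h']) hp

/-- The graph on `ZMod 2 ^ N` whose edges flip one coordinate or two consecutive ones. -/
def flipGraph (N : ℕ) : SimpleGraph (Fin N → ZMod 2) where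
  Adj x y := IsFlip (x + y)
  symm := ⟨fun x y h => by rwa [add_comm]⟩
  loopless := ⟨fun x h => not_isFlip_zero (vec_add_self x ▸ h)⟩

theorem flipGraph_adj {x y : Fin N → ZMod 2} : (flipGraph N).Adj x y ↔ IsFlip (x + y) := Iff.rfl

instance : DecidableRel (flipGraph N).Adj := fun x y =>
  inferInstanceAs (Decidable (IsFlip (x + y)))

theorem flipGraph_adj_add {x d : Fin N → ZMod 2} (hd : IsFlip d) : (flipGraph N).Adj x (x + d) := by
  rw [flipGraph_adj, vec_add_cancel]
  exact hd

theorem isFlip_unitVec (m : Fin N) : IsFlip (unitVec N m) := ⟨m, m.2, Or.inl rfl⟩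

theorem isFlip_unitVec_add {m m' : Fin N} (h : (m : ℕ) + 1 = m' ∨ (m' : ℕ) + 1 = m) :
    IsFlip (unitVec N m + unitVec N m') := by
  rcases h with h | h
  · exact ⟨m, m.2, Or.inr (by rw [h])⟩
  · exact ⟨m', m'.2, Or.inr (by rw [h, add_comm])⟩

/-- The vectors that agree with `b` outside `I`. -/
def subcube (I : Finset (Fin N)) (b : Fin N → ZMod 2) : Set (Fin N → ZMod 2) :=
  {v | ∀ j, j ∉ I → v j = b j}

theorem subcube_insert (I : Finset (Fin N)) (m : Fin N) (b : Fin N → ZMod 2) :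
    subcube (insert m I) b = subcube I b ∪ subcube I (b + unitVec N m) := by
  have hne : ∀ j : Fin N, j ≠ m → unitVec N m j = 0 := fun j h =>
    unitVec_of_ne fun h' => h (Fin.ext h')
  have hmm : unitVec N m m = 1 := by simp [unitVec]
  ext v
  constructor
  · intro hv
    have hv' : ∀ j, j ∉ I → j ≠ m → v j = b j := fun j hj hjm => hv j (by simp [hj, hjm])
    have h2 : v m = b m ∨ v m = b m + 1 := by
      generalize v m = s
      generalize b m = t
      revert s t
      decide
    rcases h2 with h | h
    · left
      intro j hj
      by_cases hjm : j = m
      · rw [hjm, h]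
      · exact hv' j hj hjm
    · right
      intro j hj
      by_cases hjm : j = m
      · rw [hjm, h, Pi.add_apply, hmm]
      · rw [hv' j hj hjm, Pi.add_apply, hne j hjm, add_zero]
  · rintro (hv | hv) j hj
    · exact hv j fun h => hj (by simp [h])
    · rw [hv j fun h => hj (by simp [h]), Pi.add_apply, hne j (fun h => hj (by simp [h])), add_zero]

theorem exists_finset_subcube (I : Finset (Fin N)) (b : Fin N → ZMod 2) :
    ∃ S : Finset (Fin N → ZMod 2), (∀ v ∈ S, v ∈ subcube I b) ∧ S.card = 2 ^ I.card := by
  classical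
  refine ⟨I.powerset.image fun J j => if j ∈ J then b j + 1 else b j, ?_, ?_⟩
  · intro v hv
    obtain ⟨J, hJ, rfl⟩ := Finset.mem_image.1 hv
    intro j hj
    exact if_neg fun h => hj (Finset.mem_powerset.1 hJ h)
  · rw [Finset.card_image_of_injective, Finset.card_powerset]
    intro J J' h
    ext j
    have := congrFun h j
    by_cases h1 : j ∈ J <;> by_cases h2 : j ∈ J' <;> simp_all

theorem subcube_add {I : Finset (Fin N)} {b v d : Fin N → ZMod 2} {c : Fin N → ZMod 2}
    (hv : v ∈ subcube I b) (hd : ∀ j, j ∉ I → d j = c j) : v + d ∈ subcube I (b + c) :=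
  fun j hj => by rw [Pi.add_apply, Pi.add_apply, hv j hj, hd j hj]

/-- Translation by e_m matches the two halves by 2^|I| ≥ k + c disjoint edges, so fewer than k + c
deletions spare one of them. Translations by the elements of T give each vertex its c neighbours
across. -/
theorem connectedWithin_subcube_insert {I : Finset (Fin N)} {m : Fin N} {k c : ℕ} (hm : m ∉ I)
    (hck : c ≤ k) (hI : ∀ b, ConnectedWithin (flipGraph N) (subcube I b) k)
    (hcard : k + c ≤ 2 ^ I.card)
    (hT : ∃ T : Finset (Fin N → ZMod 2), c ≤ T.card ∧
      ∀ t ∈ T, IsFlip t ∧ ∀ j, j ∉ I → t j = unitVec N m j) (b : Fin N → ZMod 2) :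
    ConnectedWithin (flipGraph N) (subcube (insert m I) b) (k + c) := by
  classical
  obtain ⟨T, hTc, hT⟩ := hT
  have hnb : ∀ b, ∀ v ∈ subcube I b, ∃ T : Finset (Fin N → ZMod 2), c ≤ T.card ∧
      ∀ t ∈ T, t ∈ subcube I (b + unitVec N m) ∧ (flipGraph N).Adj v t := by
    intro b v hv
    refine ⟨T.image (v + ·), ?_, ?_⟩
    · rwa [Finset.card_image_of_injective _ (add_right_injective v)]
    · intro t ht
      obtain ⟨s, hs, rfl⟩ := Finset.mem_image.1 ht
      exact ⟨subcube_add hv (hT s hs).2, flipGraph_adj_add (hT s hs).1⟩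
  have hdisj : Disjoint (subcube I b) (subcube I (b + unitVec N m)) := by
    rw [Set.disjoint_left]
    intro v h1 h2
    have := (h1 m hm).symm.trans (h2 m hm)
    simp [unitVec] at this
  rw [subcube_insert]
  refine ConnectedWithin.union hck hdisj (hI _) (hI _) (hnb b) ?_ ?_
  · have := hnb (b + unitVec N m)
    rwa [add_assoc, vec_add_self, add_zero] at this
  · intro W hW
    obtain ⟨S, hS, hSc⟩ := exists_finset_subcube I b
    by_contra! hcon
    have hmem : ∀ v ∈ S, v + unitVec N m ∈ subcube I (b + unitVec N m) := fun v hv =>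
      subcube_add (hS v hv) fun _ _ => rfl
    -- If every matching edge is hit, choosing a deleted end of each one injects S into W.
    have hle : S.card ≤ W.card := by
      refine Finset.card_le_card_of_injOn (fun v => if v ∈ W then v else v + unitVec N m) ?_ ?_
      · intro v hv
        by_cases h : v ∈ W
        · simp [h]
        · simpa [h] using hcon v (hS v hv) _ (hmem v hv) (flipGraph_adj_add (isFlip_unitVec m)) h
      · intro v hv v' hv' h
        have hn : ∀ u ∈ S, ∀ w ∈ S, u ≠ w + unitVec N m := fun u hu w hw h =>
          Set.disjoint_left.1 hdisj (hS u hu) (h ▸ hmem w hw)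
        by_cases h1 : v ∈ W <;> by_cases h2 : v' ∈ W <;> simp only [h1, h2, if_true, if_false] at h
        · exact h
        · exact absurd h (hn v hv v' hv')
        · exact absurd h.symm (hn v' hv' v hv)
        · exact add_right_cancel h
    omega

/-- The unit flips alone already give a 4-cycle, so the coordinates need not be consecutive. This
allows the growth to start on both sides of a fixed coordinate. -/
theorem connectedWithin_subcube_pair {m m' : Fin N} (h : m ≠ m') (b : Fin N → ZMod 2) :
    ConnectedWithin (flipGraph N) (subcube {m, m'} b) 2 := by
  have h0 : ∀ b, ConnectedWithin (flipGraph N) (subcube ∅ b) 1 := by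
    intro b W _ x hx y hy hxW _
    have : x = y := by
      funext j
      rw [hx j (by simp), hy j (by simp)]
    subst this
    exact .refl ⟨hx, hxW⟩
  have h1 := connectedWithin_subcube_insert (m := m') (by simp) (Nat.zero_le 1) h0 (by simp)
    ⟨∅, by simp⟩
  exact connectedWithin_subcube_insert (by simpa using h) le_rfl h1 (by simp)
    ⟨{unitVec N m}, by simp, by simp [isFlip_unitVec m]⟩ b

/-- With a consecutive coordinate m' already free, both e_m and e_m + e_{m'} lead across, so the
connectivity rises by two. -/
theorem connectedWithin_subcube_grow {I : Finset (Fin N)} {m m' : Fin N} (hm : m ∉ I)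
    (hm' : m' ∈ I) (hadj : (m : ℕ) + 1 = m' ∨ (m' : ℕ) + 1 = m) (hI2 : 2 ≤ I.card)
    (hI : ∀ b, ConnectedWithin (flipGraph N) (subcube I b) (2 * (I.card - 1)))
    (b : Fin N → ZMod 2) :
    ConnectedWithin (flipGraph N) (subcube (insert m I) b) (2 * ((insert m I).card - 1)) := by
  have hpow : ∀ n : ℕ, 2 ≤ n → 2 * n ≤ 2 ^ n := by
    intro n hn
    induction n, hn using Nat.le_induction with
    | base => norm_num
    | succ n hn ih => rw [pow_succ]; omega
  have := hpow _ hI2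
  rw [Finset.card_insert_of_notMem hm]
  have e : 2 * (I.card + 1 - 1) = 2 * (I.card - 1) + 2 := by omega
  rw [e]
  refine connectedWithin_subcube_insert hm (by omega) hI (by omega)
    ⟨{unitVec N m, unitVec N m + unitVec N m'}, ?_, ?_⟩ b
  · rw [Finset.card_pair]
    intro h
    have := congrFun h m'
    simp [unitVec] at this
  · intro t ht
    simp only [Finset.mem_insert, Finset.mem_singleton] at ht
    rcases ht with rfl | rfl
    · exact ⟨isFlip_unitVec m, fun _ _ => rfl⟩
    · refine ⟨isFlip_unitVec_add hadj, fun j hj => ?_⟩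
      rw [Pi.add_apply, unitVec_of_ne (m := m') (fun h => hj ((Fin.ext h : j = m') ▸ hm')), add_zero]

/-- Fixing coordinate i breaks the line of coordinates in two. As I contains the neighbours of i,
each side can be filled up by adding only coordinates consecutive to free ones. -/
theorem connectedWithin_subcube_of_neighbours (i : Fin N) (I : Finset (Fin N)) (hi : i ∉ I)
    (hnb : ∀ j : Fin N, ((j : ℕ) + 1 = i ∨ (i : ℕ) + 1 = j) → j ∈ I) (hI2 : 2 ≤ I.card)
    (hI : ∀ b, ConnectedWithin (flipGraph N) (subcube I b) (2 * (I.card - 1)))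
    (b : Fin N → ZMod 2) :
    ConnectedWithin (flipGraph N) (subcube (Finset.univ.erase i) b) (2 * (N - 2)) := by
  by_cases hfull : I = Finset.univ.erase i
  · have := hI b
    rw [hfull, Finset.card_erase_of_mem (Finset.mem_univ _), Finset.card_univ,
      Fintype.card_fin] at this
    exact this
  · obtain ⟨m, hmI, hmi, m', hm', hadj⟩ : ∃ m ∉ I, m ≠ i ∧ ∃ m' ∈ I,
        (m : ℕ) + 1 = m' ∨ (m' : ℕ) + 1 = m := by
      obtain ⟨m, hm, hmI⟩ : ∃ m, m ≠ i ∧ m ∉ I := by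
        by_contra! hcon
        refine hfull (Finset.ext fun j => ?_)
        rw [Finset.mem_erase]
        exact ⟨fun hj => ⟨fun h => hi (h ▸ hj), Finset.mem_univ _⟩, fun hj => hcon j hj.1⟩
      -- Otherwise non-membership in I would propagate from m step by step up to a neighbour of i,
      -- which lies in I.
      by_contra! hcon
      rcases lt_or_gt_of_ne (fun h => hm (Fin.ext h) : (m : ℕ) ≠ i) with hlt | hlt
      · have key : ∀ n : ℕ, ∀ h : n < N, (m : ℕ) ≤ n → n < i → (⟨n, h⟩ : Fin N) ∉ I := by
          intro n h hmn
          induction n, hmn using Nat.le_induction with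
          | base => exact fun _ => hmI
          | succ n hmn ih =>
            intro hni hmem
            exact (hcon ⟨n, by omega⟩ (ih (by omega) (by omega))
              (fun h => by rw [← h] at hni; simp at hni) _ hmem).1 rfl
        exact key (i - 1) (by omega) (by omega) (by omega) (hnb _ (Or.inl (by simp; omega)))
      · have key : ∀ n : ℕ, (i : ℕ) < m - n → (⟨m - n, by omega⟩ : Fin N) ∉ I := by
          intro n
          induction n with
          | zero => exact fun _ => hmI
          | succ n ih =>
            intro hni hmem
            exact (hcon ⟨m - n, by omega⟩ (ih (by omega))
              (fun h => by rw [← h] at hni; simp at hni; omega) _ hmem).2 (by simp; omega)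
        exact key (m - i - 1) (by omega) (hnb _ (Or.inr (by simp; omega)))
    exact connectedWithin_subcube_of_neighbours i (insert m I)
      (by simpa [hi] using hmi.symm) (fun j hj => Finset.mem_insert_of_mem (hnb j hj))
      (hI2.trans (Finset.card_le_card (Finset.subset_insert _ _)))
      (connectedWithin_subcube_grow hmI hm' hadj hI2 hI) b
termination_by N - I.card
decreasing_by
  have h1 : (insert m I).card ≤ N := by simpa using Finset.card_le_univ (insert m I)
  rw [Finset.card_insert_of_notMem hmI] at h1 ⊢
  omega

/-- The half of the flip graph with a fixed `i`-th coordinate is `2(N - 2)`-connected. -/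
theorem connectedWithin_subcube_erase (hN : 3 ≤ N) (i : Fin N) (b : Fin N → ZMod 2) :
    ConnectedWithin (flipGraph N) (subcube (Finset.univ.erase i) b) (2 * (N - 2)) := by
  obtain ⟨m, m', hmm, hmi, hmi', hnb⟩ : ∃ m m' : Fin N, m ≠ m' ∧ i ≠ m ∧ i ≠ m' ∧
      ∀ j : Fin N, ((j : ℕ) + 1 = i ∨ (i : ℕ) + 1 = j) → j = m ∨ j = m' := by
    by_cases h0 : (i : ℕ) = 0
    · refine ⟨⟨1, by omega⟩, ⟨2, by omega⟩, ?_⟩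
      simp only [Fin.ext_iff, ne_eq]
      exact ⟨by omega, by omega, by omega, fun j hj => by omega⟩
    by_cases h1 : (i : ℕ) = N - 1
    · refine ⟨⟨N - 2, by omega⟩, ⟨N - 3, by omega⟩, ?_⟩
      simp only [Fin.ext_iff, ne_eq]
      exact ⟨by omega, by omega, by omega, fun j hj => by omega⟩
    · refine ⟨⟨i - 1, by omega⟩, ⟨i + 1, by omega⟩, ?_⟩
      simp only [Fin.ext_iff, ne_eq]
      exact ⟨by omega, by omega, by omega, fun j hj => by omega⟩
  have hc : ({m, m'} : Finset (Fin N)).card = 2 := Finset.card_pair hmm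
  refine connectedWithin_subcube_of_neighbours i {m, m'} (by simp [hmi, hmi'])
    (fun j hj => by simpa using hnb j hj) hc.ge (fun b => ?_) b
  rw [hc]
  exact connectedWithin_subcube_pair hmm b

end FlipGraph

/-! ### Transport along isomorphisms, and paths given by vertex lists. -/

section Transfer

variable {V V' : Type*} {G : SimpleGraph V} {G' : SimpleGraph V'}

theorem HasDisjointDPaths.map {D : Finset V} {m : ℕ} (h : HasDisjointDPaths G D m) (f : G ≃g G') :
    HasDisjointDPaths G' (D.map f.toEquiv.toEmbedding) m := by
  obtain ⟨s, t, P, hP, hd⟩ := h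
  have hinj : Function.Injective f := f.injective
  refine ⟨fun i => f (s i), fun i => f (t i), fun i => (P i).map f.toHom, fun i => ⟨?_, ?_⟩,
    fun i j hij => ⟨?_, ?_⟩⟩
  · exact (hP i).1.map hinj
  · intro w hw
    obtain ⟨v, hv, rfl⟩ := Finset.mem_map.1 hw
    rw [SimpleGraph.Walk.support_map]
    exact List.mem_map_of_mem ((hP i).2 v hv)
  · have h1 := (hd i j hij).1
    ext w
    obtain ⟨v, rfl⟩ := f.surjective w
    have hmem : ∀ i, f v ∈ ((P i).map f.toHom).support ↔ v ∈ (P i).support := by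
      intro i
      rw [SimpleGraph.Walk.support_map]
      exact List.mem_map_of_injective hinj
    have h2 := Set.ext_iff.1 h1 v
    simp only [Set.mem_inter_iff, Set.mem_ofPred_eq, Finset.mem_coe] at h2 ⊢
    rw [hmem, hmem, h2]
    constructor
    · exact fun h => Finset.mem_map_of_mem f.toEquiv.toEmbedding h
    · intro h
      obtain ⟨u, hu, huv⟩ := Finset.mem_map.1 h
      rwa [← hinj huv]
  · have h1 := (hd i j hij).2
    rw [Set.eq_empty_iff_forall_notMem] at h1 ⊢
    rintro e ⟨hi, hj⟩
    simp only [Set.mem_ofPred_eq, SimpleGraph.Walk.edges_map, List.mem_map] at hi hj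
    obtain ⟨e1, h2, rfl⟩ := hi
    obtain ⟨e2, h3, h4⟩ := hj
    have := Sym2.map.injective hinj h4
    exact h1 e1 ⟨h2, this ▸ h3⟩

/-- Internally disjoint paths from explicit vertex lists that use no edge inside `D`. -/
theorem hasDisjointDPaths_of_lists {D : Finset V} {m : ℕ} (l : Fin m → List V)
    (hne : ∀ i, l i ≠ []) (hc : ∀ i, (l i).IsChain fun a b => G.Adj a b ∧ ¬ (a ∈ D ∧ b ∈ D))
    (hn : ∀ i, (l i).Nodup) (hD : ∀ i, ∀ w ∈ D, w ∈ l i)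
    (hd : ∀ i j, i ≠ j → ∀ v ∈ l i, v ∈ l j → v ∈ D) : HasDisjointDPaths G D m := by
  let G₁ : SimpleGraph V :=
    { Adj := fun a b => G.Adj a b ∧ ¬ (a ∈ D ∧ b ∈ D)
      symm := ⟨fun a b h => ⟨h.1.symm, fun h' => h.2 h'.symm⟩⟩
      loopless := ⟨fun a h => G.loopless.irrefl a h.1⟩ }
  have hle : G₁ ≤ G := fun a b h => h.1
  let P := fun i => SimpleGraph.Walk.ofSupport (G := G₁) (l i) (hne i) (hc i)
  have hPs : ∀ i, (P i).support = l i := fun i => SimpleGraph.Walk.support_ofSupport _ _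
  refine ⟨_, _, fun i => (P i).mapLe hle, fun i => ⟨?_, ?_⟩, fun i j hij => ⟨?_, ?_⟩⟩
  · rw [SimpleGraph.Walk.isPath_def, SimpleGraph.Walk.support_mapLe_eq_support, hPs]
    exact hn i
  · rw [SimpleGraph.Walk.support_mapLe_eq_support, hPs]
    exact hD i
  · simp only [SimpleGraph.Walk.support_mapLe_eq_support, hPs]
    ext v
    exact ⟨fun h => hd i j hij v h.1 h.2, fun h => ⟨hD i v h, hD j v h⟩⟩
  · rw [Set.eq_empty_iff_forall_notMem]
    rintro e ⟨hi, hj⟩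
    simp only [SimpleGraph.Walk.edges_mapLe_eq_edges, Set.mem_ofPred_eq] at hi hj
    have key : ∀ v ∈ e, v ∈ D := by
      intro v hv
      have h1 := SimpleGraph.Walk.mem_support_of_mem_edges hi hv
      have h2 := SimpleGraph.Walk.mem_support_of_mem_edges hj hv
      rw [hPs] at h1 h2
      exact hd i j hij v h1 h2
    induction e with
    | _ v w =>
    exact (SimpleGraph.Walk.adj_of_mem_edges _ hi).2 ⟨key v (by simp), key w (by simp)⟩

end Transfer

/-! ### Common neighbours and the lower bound. -/

section LowerBound

variable {N : ℕ}

theorem add_ne_zero_of_ne {x y : Fin N → ZMod 2} (h : x ≠ y) : x + y ≠ 0 := fun h0 => by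
  have := vec_eq_of_add_eq h0
  rw [add_zero] at this
  exact h this.symm

/-- Exactly one of s and s + e_p is nonzero at p. It is not e_p, since the other would be 0, so it
is e_p plus a neighbouring unit vector. -/
theorem common_flip_of_unit {p : ℕ} {s : Fin N → ZMod 2} (hp : p < N)
    (hs : IsFlip s) (ht : IsFlip (s + unitVec N p)) :
    (p + 1 < N ∧ (s = unitVec N (p + 1) ∨ s = unitVec N p + unitVec N (p + 1))) ∨
      ∃ m, m + 1 = p ∧ (s = unitVec N m ∨ s = unitVec N m + unitVec N p) := by
  have key : ∀ s : Fin N → ZMod 2, IsFlip s → IsFlip (s + unitVec N p) → s ⟨p, hp⟩ ≠ 0 →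
      (p + 1 < N ∧ s = unitVec N p + unitVec N (p + 1)) ∨
      ∃ m, m + 1 = p ∧ s = unitVec N m + unitVec N p := by
    intro s hs ht hsp
    rcases hs.cases_of_ne_zero hsp with rfl | rfl | ⟨m, hm, rfl⟩
    · exact absurd (vec_add_self _ ▸ ht) not_isFlip_zero
    · by_cases h : p + 1 < N
      · exact Or.inl ⟨h, rfl⟩
      · simp only [unitVec_of_le (not_lt.1 h), add_zero, vec_add_self] at ht
        exact absurd ht not_isFlip_zero
    · exact Or.inr ⟨m, hm, rfl⟩
  by_cases hsp : s ⟨p, hp⟩ = 0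
  · have h1 : (s + unitVec N p) ⟨p, hp⟩ ≠ 0 := by
      rw [Pi.add_apply, hsp, unitVec_self]
      decide
    have h2 : s + unitVec N p + unitVec N p = s := by rw [add_assoc, vec_add_self, add_zero]
    rcases key _ ht (by rwa [h2]) h1 with ⟨h, h3⟩ | ⟨m, hm, h3⟩
    · refine Or.inl ⟨h, Or.inl ?_⟩
      rw [add_comm] at h3
      exact add_left_cancel h3
    · refine Or.inr ⟨m, hm, Or.inl ?_⟩
      exact add_right_cancel h3
  · rcases key s hs ht hsp with ⟨h, h3⟩ | ⟨m, hm, h3⟩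
    · exact Or.inl ⟨h, Or.inr h3⟩
    · exact Or.inr ⟨m, hm, Or.inr h3⟩

/-- Exactly one of s and s + d is nonzero at p. It cannot be e_{p-1} + e_p: as d vanishes below p,
the other would be a flip with p - 1 as its only nonzero coordinate up to p, hence e_{p-1}, forcing
d = e_p. -/
theorem common_flip_of_ne_unit {p : Fin N} {s d : Fin N → ZMod 2} (hdp : d p ≠ 0)
    (hmin : ∀ j < p, d j = 0) (hd : d ≠ unitVec N p) (hs : IsFlip s) (ht : IsFlip (s + d)) :
    s = unitVec N p ∨ s = unitVec N p + unitVec N (p + 1) ∨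
      s = d + unitVec N p ∨ s = d + (unitVec N p + unitVec N (p + 1)) := by
  have key : ∀ s : Fin N → ZMod 2, IsFlip s → IsFlip (s + d) → s p ≠ 0 → (s + d) p = 0 →
      s = unitVec N p ∨ s = unitVec N p + unitVec N (p + 1) := by
    intro s hs ht hsp htp
    rcases hs.cases_of_ne_zero hsp with h | h | ⟨m, hm, rfl⟩
    · exact Or.inl h
    · exact Or.inr h
    · exfalso
      have hmN : m < N := by omega
      have hmp : (⟨m, hmN⟩ : Fin N) < p := by rw [Fin.lt_def]; simp; omega
      have hm0 : (unitVec N m + unitVec N p + d) ⟨m, hmN⟩ ≠ 0 := by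
        rw [Pi.add_apply, Pi.add_apply, unitVec_self, unitVec_of_ne (by simp; omega),
          hmin _ hmp]
        decide
      rcases ht.cases_of_ne_zero hm0 with h | h | ⟨m', hm', h⟩
      · apply hd
        rw [add_assoc, add_eq_left] at h
        have := vec_eq_of_add_eq h
        rwa [add_zero] at this
      · rw [h] at htp
        simp [unitVec, ← hm] at htp
      · have hmp' : (⟨m', by omega⟩ : Fin N) < p := by rw [Fin.lt_def]; simp; simp at hm'; omega
        have := congrFun h ⟨m', by omega⟩
        simp only [Pi.add_apply, hmin _ hmp'] at this
        simp at hm'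
        simp [unitVec, ← hm, ← hm'] at this
        omega
  have hone : ∀ a : ZMod 2, a ≠ 0 → a = 1 := by decide
  have h2 : s + d + d = s := by rw [add_assoc, vec_add_self, add_zero]
  by_cases hsp : s p = 0
  · have := key (s + d) ht (by rwa [h2]) (by rw [Pi.add_apply, hsp, zero_add]; exact hdp)
      (by rw [h2]; exact hsp)
    rcases this with h | h
    · rw [h, add_comm] at h2
      exact Or.inr (Or.inr (Or.inl h2.symm))
    · rw [h, add_comm] at h2
      exact Or.inr (Or.inr (Or.inr h2.symm))
  · have := key s hs ht hsp (by
      rw [Pi.add_apply, hone _ hsp, hone _ hdp]; decide)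
    tauto

theorem exists_min_ne_zero {d : Fin N → ZMod 2} (hd : d ≠ 0) :
    ∃ p, d p ≠ 0 ∧ ∀ j < p, d j = 0 := by
  obtain ⟨p, hp⟩ := Function.ne_iff.1 hd
  obtain ⟨p, hp, hmin⟩ := WellFounded.has_min (wellFounded_lt (α := Fin N)) {p | d p ≠ 0} ⟨p, hp⟩
  exact ⟨p, hp, fun j hj => by_contra fun h => hmin j h hj⟩

theorem card_common_le_four {x y : Fin N → ZMod 2} (hxy : x ≠ y) (C : Finset (Fin N → ZMod 2))
    (hC : ∀ c ∈ C, (flipGraph N).Adj x c ∧ (flipGraph N).Adj c y) : C.card ≤ 4 := by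
  obtain ⟨p, hp, hmin⟩ := exists_min_ne_zero (add_ne_zero_of_ne hxy)
  have hC' : ∀ c ∈ C, IsFlip (x + c) ∧ IsFlip (x + c + (x + y)) := fun c hc => by
    refine ⟨(hC c hc).1, ?_⟩
    have : x + c + (x + y) = c + y := by rw [add_comm x c, add_assoc, vec_add_cancel]
    rw [this]
    exact (hC c hc).2
  have hsub : ∀ L : Finset (Fin N → ZMod 2), L.card ≤ 4 → (∀ c ∈ C, x + c ∈ L) → C.card ≤ 4 := by
    intro L hL h
    refine le_trans ?_ hL
    exact Finset.card_le_card_of_injOn (x + ·) h (add_right_injective x).injOn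
  by_cases hd : x + y = unitVec N p
  · refine hsub {unitVec N (p + 1), unitVec N p + unitVec N (p + 1), unitVec N (p - 1),
      unitVec N (p - 1) + unitVec N p} Finset.card_le_four fun c hc => ?_
    obtain ⟨h1, h2⟩ := hC' c hc
    rw [hd] at h2
    simp only [Finset.mem_insert, Finset.mem_singleton]
    rcases common_flip_of_unit p.2 h1 h2 with ⟨-, h | h⟩ | ⟨m, hm, h⟩
    · exact Or.inl h
    · exact Or.inr (Or.inl h)
    · have : (p : ℕ) - 1 = m := by omega
      rw [this]
      exact Or.inr (Or.inr h)
  · refine hsub {unitVec N p, unitVec N p + unitVec N (p + 1), x + y + unitVec N p,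
      x + y + (unitVec N p + unitVec N (p + 1))} Finset.card_le_four fun c hc => ?_
    obtain ⟨h1, h2⟩ := hC' c hc
    simpa only [Finset.mem_insert, Finset.mem_singleton] using
      common_flip_of_ne_unit hp hmin hd h1 h2

/-- Adjacent vertices have at most two common neighbours with a given `i`-th coordinate, unless
they differ in a single coordinate both of whose neighbouring coordinates are other than `i`. -/
theorem card_common_le_two {x y : Fin N → ZMod 2} (i : Fin N) (hadj : (flipGraph N).Adj x y)
    (hbad : ¬ ∃ m : ℕ, m + 2 < N ∧ m ≠ i ∧ m + 2 ≠ i ∧ x + y = unitVec N (m + 1))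
    (C : Finset (Fin N → ZMod 2))
    (hC : ∀ c ∈ C, x i = c i ∧ (flipGraph N).Adj x c ∧ (flipGraph N).Adj c y) : C.card ≤ 2 := by
  obtain ⟨p, hp, hmin⟩ := exists_min_ne_zero (add_ne_zero_of_ne hadj.ne)
  have hC' : ∀ c ∈ C, IsFlip (x + c) ∧ IsFlip (x + c + (x + y)) ∧ (x + c) i = 0 := fun c hc => by
    refine ⟨(hC c hc).2.1, ?_, ?_⟩
    · have : x + c + (x + y) = c + y := by rw [add_comm x c, add_assoc, vec_add_cancel]
      rw [this]
      exact (hC c hc).2.2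
    · rw [Pi.add_apply, (hC c hc).1]
      exact CharTwo.add_self_eq_zero _
  have hsub : ∀ a b : Fin N → ZMod 2, (∀ c ∈ C, x + c = a ∨ x + c = b) → C.card ≤ 2 := by
    intro a b h
    refine le_trans ?_ (Finset.card_le_two (a := a) (b := b))
    exact Finset.card_le_card_of_injOn (x + ·) (fun c hc => by simpa using h c hc) (add_right_injective x).injOn
  by_cases hd : x + y = unitVec N p
  · by_cases hright : (p : ℕ) + 1 < N ∧ (p : ℕ) + 1 ≠ i
    · refine hsub (unitVec N (p + 1)) (unitVec N p + unitVec N (p + 1)) fun c hc => ?_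
      obtain ⟨h1, h2, h3⟩ := hC' c hc
      rw [hd] at h2
      rcases common_flip_of_unit p.2 h1 h2 with ⟨-, h⟩ | ⟨m, hm, h⟩
      · exact h
      · exfalso
        refine hbad ⟨m, by omega, ?_, by omega, by rw [hd, hm]⟩
        rintro hmi
        rcases h with h | h <;> rw [h] at h3 <;> simp [unitVec, ← hm, ← hmi] at h3
    · refine hsub (unitVec N (p - 1)) (unitVec N (p - 1) + unitVec N p) fun c hc => ?_
      obtain ⟨h1, h2, h3⟩ := hC' c hc
      rw [hd] at h2
      rcases common_flip_of_unit p.2 h1 h2 with ⟨hpN, h⟩ | ⟨m, hm, h⟩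
      · exfalso
        have hi : (p : ℕ) + 1 = i := by
          by_contra hne
          exact hright ⟨hpN, hne⟩
        rcases h with h | h <;> rw [h] at h3 <;> simp [unitVec, ← hi] at h3
      · have : (p : ℕ) - 1 = m := by omega
        rw [this]
        exact h
  · have hd2 : x + y = unitVec N p + unitVec N (p + 1) := by
      rcases (flipGraph_adj.1 hadj).cases_of_ne_zero hp with h | h | ⟨m, hm, h⟩
      · exact absurd h hd
      · exact h
      · exfalso
        have := hmin ⟨m, by omega⟩ (by rw [Fin.lt_def]; simp; omega)
        rw [h] at this
        simp [unitVec, ← hm] at this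
    refine hsub (unitVec N p) (x + y + unitVec N p) fun c hc => ?_
    obtain ⟨h1, h2, -⟩ := hC' c hc
    rcases common_flip_of_ne_unit hp hmin hd h1 h2 with h | h | h | h
    · exact Or.inl h
    · rw [h, ← hd2, vec_add_self] at h2
      exact absurd h2 not_isFlip_zero
    · exact Or.inr h
    · rw [h, ← hd2, vec_add_self] at h1
      exact absurd h1 not_isFlip_zero

/-- The lower bound for three vertices that are split two to one by the `i`-th coordinate. -/
theorem flipGraph_hasDisjointDPaths_of_split {k : ℕ} (hk : 0 < k) (hN : N = 2 * k + 1)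
    {x y z : Fin N → ZMod 2} (hxy : x ≠ y) (i : Fin N) (hi : x i = y i) (hz : x i ≠ z i)
    (hbad : N ≠ 5 ∨ ¬ ∃ m : ℕ, m + 2 < N ∧ m ≠ i ∧ m + 2 ≠ i ∧ x + y = unitVec N (m + 1)) :
    HasDisjointDPaths (flipGraph N) {x, y, z} (3 * k - 1) := by
  have hmem : ∀ b v : Fin N → ZMod 2, v ∈ subcube (Finset.univ.erase i) b ↔ v i = b i := by
    intro b v
    constructor
    · exact fun h => h i (by simp)
    · intro h j hj
      have : j = i := by simpa using hj
      rw [this, h]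
  have hconn := connectedWithin_subcube_erase (N := N) (by omega) i
  have e : 2 * (N - 2) = 2 * (2 * k - 2) + 2 := by omega
  rw [e] at hconn
  obtain ⟨S, hS, hSc⟩ := exists_finset_subcube (Finset.univ.erase i) x
  rw [Finset.card_erase_of_mem (Finset.mem_univ _), Finset.card_univ, Fintype.card_fin] at hSc
  have hpow : ∀ k : ℕ, 0 < k → 4 * k ≤ 2 ^ (2 * k) := by
    intro n hn
    induction n, hn using Nat.le_induction with
    | base => norm_num
    | succ n hn ih =>
      have : 2 ^ (2 * (n + 1)) = 4 * 2 ^ (2 * n) := by ring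
      omega
  have hpk := hpow k hk
  have e2 : N - 1 = 2 * k := by omega
  rw [e2] at hSc
  have hzi : z i = x i + 1 := by
    revert hz
    generalize x i = a
    generalize z i = b
    revert a b
    decide
  refine hasDisjointDPaths_of_halves (H₀ := subcube (Finset.univ.erase i) x)
    (H₁ := subcube (Finset.univ.erase i) z) (q := 2 * k - 2) (by omega) ?_ (hconn x) (hconn z)
    (· + unitVec N i) ?_ (add_left_injective _) S hS (by omega) ((hmem _ _).2 rfl)
    ((hmem _ _).2 hi.symm) ((hmem _ _).2 rfl) hxy ?_
  · rw [Set.disjoint_left]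
    intro v h1 h2
    rw [hmem] at h1 h2
    exact hz (h1.symm.trans h2)
  · intro v hv
    rw [hmem] at hv ⊢
    refine ⟨?_, flipGraph_adj_add (isFlip_unitVec i)⟩
    rw [Pi.add_apply, hv, hzi, unitVec_self]
  -- The allowance q + 2 is 2k. Nothing has to be cut for k = 1, and four common neighbours plus an
  -- edge fit for k ≥ 3. For k = 2 an adjacent pair needs the sharper bound, whose exception is
  -- `hbad`.
  · by_cases hk1 : k = 1
    · exact Or.inl (by omega)
    right
    intro C hC
    have h4 := card_common_le_four hxy C fun c hc => (hC c hc).2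
    refine ⟨by omega, fun hadj => ?_⟩
    by_cases hk2 : k = 2
    · have h2 := card_common_le_two i hadj (hbad.resolve_left (by omega)) C fun c hc =>
        ⟨((hmem _ _).1 (hC c hc).1).symm, (hC c hc).2⟩
      omega
    · omega

/-- Translation by `x`. -/
def flipGraphTranslate (x : Fin N → ZMod 2) : flipGraph N ≃g flipGraph N where
  toEquiv := Equiv.addLeft x
  map_rel_iff' := by
    intro a b
    have : x + a + (x + b) = a + b := by
      rw [add_comm x a, add_assoc, vec_add_cancel]
    simp only [Equiv.coe_addLeft, flipGraph_adj, this]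

/-- The binary digits of `m`. -/
def bitVec (m : ℕ) : Fin 5 → ZMod 2 := fun j => if m.testBit j then 1 else 0

/-- By translation x may be taken to be 0. The lists encode vertices in binary and use no edge
inside D, so disjointness outside D is all that has to be checked. -/
theorem flipGraph_five_exceptional (x : Fin 5 → ZMod 2) :
    HasDisjointDPaths (flipGraph 5) {x, x + unitVec 5 1, x + unitVec 5 3} 5 := by
  have h0 : HasDisjointDPaths (flipGraph 5) {bitVec 0, bitVec 2, bitVec 8} 5 := by
    refine hasDisjointDPaths_of_lists (fun i => List.map bitVec
      ((![[0, 3, 2, 14, 8], [0, 6, 2, 18, 19, 11, 8], [0, 12, 8, 10, 2], [0, 24, 8, 4, 2],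
        [2, 1, 0, 16, 8]] : Fin 5 → List ℕ) i)) ?_ ?_ ?_ ?_ ?_ <;> decide
  have h1 := h0.map (flipGraphTranslate x)
  have e : ∀ v, flipGraphTranslate x v = x + v := fun v => rfl
  have e0 : bitVec 0 = 0 := by decide
  have e1 : bitVec 2 = unitVec 5 1 := by decide
  have e2 : bitVec 8 = unitVec 5 3 := by decide
  simpa [e, e0, e1, e2, Finset.map_insert] using h1

theorem flipGraph_hasDisjointDPaths {k : ℕ} (hk : 0 < k) (hN : N = 2 * k + 1)
    (D : Finset (Fin N → ZMod 2)) (hD : D.card = 3) :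
    HasDisjointDPaths (flipGraph N) D (3 * k - 1) := by
  -- some ordering of `D` is split two to one by a coordinate
  obtain ⟨x, y, z, i, hxy, hxz, hyz, rfl, hi, hz⟩ : ∃ x y z : Fin N → ZMod 2, ∃ i,
      x ≠ y ∧ x ≠ z ∧ y ≠ z ∧ D = {x, y, z} ∧ x i = y i ∧ x i ≠ z i := by
    obtain ⟨x, y, z, hxy, hxz, hyz, rfl⟩ := Finset.card_eq_three.1 hD
    obtain ⟨i, hi⟩ := Function.ne_iff.1 hxz
    have : y i = x i ∨ y i = z i := by
      revert hi
      generalize x i = a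
      generalize y i = b
      generalize z i = c
      revert a b c
      decide
    rcases this with h | h
    · exact ⟨x, y, z, i, hxy, hxz, hyz, rfl, h.symm, hi⟩
    · refine ⟨y, z, x, i, hyz, hxy.symm, hxz.symm, ?_, h, fun h' => hi (h'.symm.trans h)⟩
      ext v
      simp only [Finset.mem_insert, Finset.mem_singleton]
      tauto
  by_cases hbad : N ≠ 5 ∨ ¬ ∃ m : ℕ, m + 2 < N ∧ m ≠ i ∧ m + 2 ≠ i ∧ x + y = unitVec N (m + 1)
  · exact flipGraph_hasDisjointDPaths_of_split hk hN hxy i hi hz hbad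
  push Not at hbad
  obtain ⟨rfl, m, hm, hmi, hmi', hxym⟩ := hbad
  have hk2 : k = 2 := by omega
  subst hk2
  clear hz hi hmi hmi' i hD
  -- now split along the coordinate in which `x` and `y` differ
  obtain ⟨x, y, hxy, hxz, hyz, hD, hxym, hpz⟩ : ∃ x' y' : Fin 5 → ZMod 2, x' ≠ y' ∧ x' ≠ z ∧
      y' ≠ z ∧ ({x, y, z} : Finset (Fin 5 → ZMod 2)) = {x', y', z} ∧
      x' + y' = unitVec 5 (m + 1) ∧ x' ⟨m + 1, by omega⟩ = z ⟨m + 1, by omega⟩ := by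
    by_cases h : x ⟨m + 1, by omega⟩ = z ⟨m + 1, by omega⟩
    · exact ⟨x, y, hxy, hxz, hyz, rfl, hxym, h⟩
    · refine ⟨y, x, hxy.symm, hyz, hxz, Finset.insert_comm _ _ _, by rwa [add_comm], ?_⟩
      have := congrFun hxym ⟨m + 1, by omega⟩
      rw [unitVec_self, Pi.add_apply] at this
      revert h this
      generalize x ⟨m + 1, by omega⟩ = a
      generalize y ⟨m + 1, by omega⟩ = b
      generalize z ⟨m + 1, by omega⟩ = c
      revert a b c
      decide
  rw [hD]
  have hpy : x ⟨m + 1, by omega⟩ ≠ y ⟨m + 1, by omega⟩ := by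
    have := congrFun hxym ⟨m + 1, by omega⟩
    rw [unitVec_self, Pi.add_apply] at this
    intro h
    rw [h, CharTwo.add_self_eq_zero] at this
    exact absurd this (by decide)
  by_cases hbad : ∃ m' : ℕ, m' + 2 < 5 ∧ m' ≠ m + 1 ∧ m' + 2 ≠ m + 1 ∧ x + z = unitVec 5 (m' + 1)
  · obtain ⟨m', hm', h1, h2, hxzm⟩ := hbad
    have hne : m ≠ m' := by
      rintro rfl
      exact hyz (add_left_cancel (hxym.trans hxzm.symm))
    -- Both indices are at most 2, and they are neither equal nor consecutive.
    have hcases : (m = 0 ∧ m' = 2) ∨ (m = 2 ∧ m' = 0) := by omega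
    rcases hcases with ⟨rfl, rfl⟩ | ⟨rfl, rfl⟩
    · rw [vec_eq_of_add_eq hxym, vec_eq_of_add_eq hxzm]
      exact flipGraph_five_exceptional x
    · rw [vec_eq_of_add_eq hxym, vec_eq_of_add_eq hxzm,
        Finset.pair_comm (x + unitVec 5 (2 + 1))]
      exact flipGraph_five_exceptional x
  · rw [Finset.pair_comm y z]
    exact flipGraph_hasDisjointDPaths_of_split (N := 5) (k := 2) (by norm_num) rfl hxz
      ⟨m + 1, by omega⟩ hpz hpy (Or.inr hbad)

end LowerBound

/-! ### The upper bound by counting edges at D. -/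

section UpperBound

variable {V : Type*} {G : SimpleGraph V} {u w v x y z : V}

theorem SimpleGraph.Walk.IsPath.exists_mem_edges {p : G.Walk u w} (hp : p.IsPath)
    (hv : v ∈ p.support) (h : ¬ (v = u ∧ v = w)) : ∃ n, s(v, n) ∈ p.edges := by
  obtain ⟨q, r, -, -, rfl⟩ := hp.mem_support_iff_exists_append.1 hv
  simp only [SimpleGraph.Walk.edges_append, List.mem_append]
  by_cases hvu : v = u
  · have hr : ¬ r.Nil := fun hn => h ⟨hvu, hn.eq⟩
    exact ⟨r.snd, Or.inr (SimpleGraph.Walk.mk_start_snd_mem_edges hr)⟩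
  · have hq : ¬ q.Nil := fun hn => hvu hn.eq.symm
    refine ⟨q.penultimate, Or.inl ?_⟩
    rw [Sym2.eq_swap]
    exact SimpleGraph.Walk.mk_penultimate_end_mem_edges hq

theorem SimpleGraph.Walk.IsPath.exists_two_mem_edges {p : G.Walk u w} (hp : p.IsPath)
    (hv : v ∈ p.support) (hvu : v ≠ u) (hvw : v ≠ w) :
    ∃ n n', n ≠ n' ∧ s(v, n) ∈ p.edges ∧ s(v, n') ∈ p.edges := by
  obtain ⟨q, r, -, -, rfl⟩ := hp.mem_support_iff_exists_append.1 hv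
  simp only [SimpleGraph.Walk.edges_append, List.mem_append]
  have hr : ¬ r.Nil := fun hn => hvw hn.eq
  have hq : ¬ q.Nil := fun hn => hvu hn.eq.symm
  have h1 := SimpleGraph.Walk.mk_start_snd_mem_edges hr
  have h2 := SimpleGraph.Walk.mk_penultimate_end_mem_edges hq
  rw [Sym2.eq_swap] at h2
  refine ⟨q.penultimate, r.snd, fun h => ?_, Or.inl h2, Or.inr h1⟩
  have := hp.isTrail.edges_nodup
  rw [SimpleGraph.Walk.edges_append, List.nodup_append] at this
  exact this.2.2 _ h2 _ h1 (by rw [h])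

theorem SimpleGraph.Walk.IsPath.eq_of_three_mem_edges {p : G.Walk u w} (hp : p.IsPath)
    (hx : s(v, x) ∈ p.edges) (hy : s(v, y) ∈ p.edges) (hz : s(v, z) ∈ p.edges) :
    x = y ∨ x = z ∨ y = z := by
  have hv := SimpleGraph.Walk.fst_mem_support_of_mem_edges _ hx
  obtain ⟨q, r, hq, hr, rfl⟩ := hp.mem_support_iff_exists_append.1 hv
  have key : ∀ n, s(v, n) ∈ (q.append r).edges → n = q.penultimate ∨ n = r.snd := by
    intro n hn
    rw [SimpleGraph.Walk.edges_append, List.mem_append] at hn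
    exact hn.imp hq.eq_penultimate_of_mem_edges hr.eq_snd_of_mem_edges
  rcases key x hx with h | h <;> rcases key y hy with h' | h' <;> rcases key z hz with h'' | h'' <;>
    simp_all

/-- The pairs `(d, v)` for which `p` uses the edge `dv` at `d ∈ D`. -/
noncomputable def usedDarts {V : Type*} [Fintype V] {G : SimpleGraph V} (D : Finset V) {u w : V}
    (p : G.Walk u w) : Finset (V × V) := by
  classical exact {e | e.1 ∈ D ∧ s(e.1, e.2) ∈ p.edges}

theorem mem_usedDarts [Fintype V] {D : Finset V} {p : G.Walk u w} {e : V × V} :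
    e ∈ usedDarts D p ↔ e.1 ∈ D ∧ s(e.1, e.2) ∈ p.edges := by
  simp [usedDarts]

/-- A path has only two ends, so one vertex of D is interior and meets two path edges; each of the
other two meets at least one. -/
theorem four_le_card_usedDarts [Fintype V] {D : Finset V} (hD : D.card = 3) {p : G.Walk u w}
    (hp : IsDPath G D p) : 4 ≤ (usedDarts D p).card := by
  classical
  obtain ⟨x, y, z, hxy, hxz, hyz, hDe, hxu, hxw⟩ : ∃ x y z : V, x ≠ y ∧ x ≠ z ∧ y ≠ z ∧
      D = {x, y, z} ∧ x ≠ u ∧ x ≠ w := by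
    have hlt : ({u, w} : Finset V).card < D.card := by
      have := Finset.card_le_two (a := u) (b := w)
      omega
    obtain ⟨x, hx, hxn⟩ := Finset.exists_mem_notMem_of_card_lt_card hlt
    have h2 : (D.erase x).card = 2 := by rw [Finset.card_erase_of_mem hx, hD]
    obtain ⟨y, z, hyz, he⟩ := Finset.card_eq_two.1 h2
    have hy : y ∈ D.erase x := by simp [he]
    have hz : z ∈ D.erase x := by simp [he]
    simp only [Finset.mem_insert, Finset.mem_singleton, not_or] at hxn
    exact ⟨x, y, z, (Finset.ne_of_mem_erase hy).symm, (Finset.ne_of_mem_erase hz).symm, hyz,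
      by rw [← he, Finset.insert_erase hx], hxn.1, hxn.2⟩
  have hxD : x ∈ D := by simp [hDe]
  have hyD : y ∈ D := by simp [hDe]
  have hzD : z ∈ D := by simp [hDe]
  have huw : u ≠ w := by
    rintro rfl
    have hn := SimpleGraph.Walk.isPath_iff_nil.1 hp.1
    have := hp.2 x hxD
    rw [SimpleGraph.Walk.nil_iff_support_eq.1 hn] at this
    exact hxu (List.mem_singleton.1 this)
  obtain ⟨n, n', hnn, hn, hn'⟩ := hp.1.exists_two_mem_edges (hp.2 x hxD) hxu hxw
  obtain ⟨b, hb⟩ := hp.1.exists_mem_edges (hp.2 y hyD) fun h => huw (h.1.symm.trans h.2)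
  obtain ⟨c, hc⟩ := hp.1.exists_mem_edges (hp.2 z hzD) fun h => huw (h.1.symm.trans h.2)
  have h4 : ({(x, n), (x, n'), (y, b), (z, c)} : Finset (V × V)).card = 4 := by
    rw [Finset.card_insert_of_notMem, Finset.card_insert_of_notMem, Finset.card_pair] <;>
      simp [hxy, hxz, hyz, hnn]
  rw [← h4]
  refine Finset.card_le_card fun e he => ?_
  simp only [Finset.mem_insert, Finset.mem_singleton] at he
  rw [mem_usedDarts]
  rcases he with rfl | rfl | rfl | rfl
  exacts [⟨hxD, hn⟩, ⟨hxD, hn'⟩, ⟨hyD, hb⟩, ⟨hzD, hc⟩]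

/-- Counting edges at `D`: each path uses four of them, and each common neighbour of the three
vertices wastes one. -/
theorem HasDisjointDPaths.four_mul_add_le [Fintype V] {D : Finset V} {m r : ℕ} (hD : D.card = 3)
    (h : HasDisjointDPaths G D m)
    (hr : ∀ d ∈ D, ∃ B : Finset V, B.card ≤ r ∧ ∀ v, G.Adj d v → v ∈ B)
    (C : Finset V) (hC : ∀ c ∈ C, c ∉ D ∧ ∀ d ∈ D, G.Adj d c) :
    4 * m + C.card ≤ 3 * r := by
  classical
  obtain ⟨s, t, P, hP, hd⟩ := h
  let T := fun i => usedDarts D (P i)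
  let Δ : Finset (V × V) := {e | e.1 ∈ D ∧ G.Adj e.1 e.2}
  have hΔ : Δ.card ≤ 3 * r := by
    choose! B hBc hB using hr
    have h1 : Δ.card ≤ (D.sigma B).card := by
      refine Finset.card_le_card_of_injOn (fun e => ⟨e.1, e.2⟩) ?_ ?_
      · intro e he
        have he' := (Finset.mem_filter.1 he).2
        simpa using ⟨he'.1, hB _ he'.1 _ he'.2⟩
      · rintro ⟨a, b⟩ - ⟨a', b'⟩ - h
        simp only [Sigma.mk.injEq, heq_eq_eq] at h
        rw [h.1, h.2]
    rw [Finset.card_sigma] at h1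
    have h2 := Finset.sum_le_card_nsmul D _ r hBc
    rw [hD, smul_eq_mul] at h2
    omega
  -- If all three edges at c were used, they would lie on a single path, as c is not in D; but a
  -- path has at most two edges at a vertex.
  have hwaste : ∀ c ∈ C, ∃ d ∈ D, ∀ i, (d, c) ∉ T i := by
    intro c hc
    by_contra! hcon
    obtain ⟨x, y, z, hxy, hxz, hyz, rfl⟩ := Finset.card_eq_three.1 hD
    have huse : ∀ d ∈ ({x, y, z} : Finset V), ∃ i, s(c, d) ∈ (P i).edges := by
      intro d hd
      obtain ⟨i, hi⟩ := hcon d hd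
      exact ⟨i, by rw [Sym2.eq_swap]; exact (mem_usedDarts.1 hi).2⟩
    have hsame : ∀ i j d d', s(c, d) ∈ (P i).edges → s(c, d') ∈ (P j).edges → i = j := by
      intro i j d d' hi hj
      by_contra hij
      have : c ∈ (({x, y, z} : Finset V) : Set V) := (hd i j hij).1 ▸
        ⟨SimpleGraph.Walk.fst_mem_support_of_mem_edges _ hi,
          SimpleGraph.Walk.fst_mem_support_of_mem_edges _ hj⟩
      exact (hC c hc).1 this
    obtain ⟨i, hi⟩ := huse x (by simp)
    obtain ⟨j, hj⟩ := huse y (by simp)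
    obtain ⟨l, hl⟩ := huse z (by simp)
    obtain rfl := hsame _ _ _ _ hi hj
    obtain rfl := hsame _ _ _ _ hi hl
    rcases (hP i).1.eq_of_three_mem_edges hi hj hl with h | h | h
    exacts [hxy h, hxz h, hyz h]
  choose! f hfD hf using hwaste
  have hUc : (C.image fun c => (f c, c)).card = C.card :=
    Finset.card_image_of_injective _ fun a b h => (Prod.ext_iff.1 h).2
  have hTdis : ((Finset.univ : Finset (Fin m)) : Set (Fin m)).PairwiseDisjoint T := by
    intro i _ j _ hij
    rw [Function.onFun, Finset.disjoint_left]
    intro e hi hj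
    have := (hd i j hij).2
    rw [Set.eq_empty_iff_forall_notMem] at this
    exact this _ ⟨(mem_usedDarts.1 hi).2, (mem_usedDarts.1 hj).2⟩
  have hdisj : Disjoint (Finset.univ.biUnion T) (C.image fun c => (f c, c)) := by
    rw [Finset.disjoint_left]
    intro e he he'
    obtain ⟨i, -, hi⟩ := Finset.mem_biUnion.1 he
    obtain ⟨c, hc, rfl⟩ := Finset.mem_image.1 he'
    exact hf c hc i hi
  have hsub : Finset.univ.biUnion T ∪ (C.image fun c => (f c, c)) ⊆ Δ := by
    intro e he
    rw [Finset.mem_filter]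
    refine ⟨Finset.mem_univ _, ?_⟩
    rcases Finset.mem_union.1 he with he | he
    · obtain ⟨i, -, hi⟩ := Finset.mem_biUnion.1 he
      have := mem_usedDarts.1 hi
      exact ⟨this.1, SimpleGraph.Walk.adj_of_mem_edges _ this.2⟩
    · obtain ⟨c, hc, rfl⟩ := Finset.mem_image.1 he
      exact ⟨hfD c hc, (hC c hc).2 _ (hfD c hc)⟩
  have h1 := Finset.card_le_card hsub
  rw [Finset.card_union_of_disjoint hdisj, hUc, Finset.card_biUnion hTdis] at h1
  have h2 := Finset.card_nsmul_le_sum Finset.univ (fun i => (T i).card) 4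
    fun i _ => four_le_card_usedDarts hD (hP i)
  rw [Finset.card_univ, Fintype.card_fin, smul_eq_mul] at h2
  omega

/-- The sum e_{N-1} + e_N is just e_{N-1}, so there are N single and only N - 1 double flips. -/
theorem flipGraph_degree_le {N : ℕ} (hN : 0 < N) (x : Fin N → ZMod 2) :
    ∃ B : Finset (Fin N → ZMod 2), B.card ≤ 2 * N - 1 ∧ ∀ v, (flipGraph N).Adj x v → v ∈ B := by
  classical
  refine ⟨(Finset.range N).image (fun m => x + unitVec N m) ∪
    (Finset.range (N - 1)).image (fun m => x + (unitVec N m + unitVec N (m + 1))), ?_, ?_⟩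
  · refine (Finset.card_union_le _ _).trans ?_
    have h1 := (Finset.card_image_le (s := Finset.range N) (f := fun m => x + unitVec N m))
    have h2 := (Finset.card_image_le (s := Finset.range (N - 1))
      (f := fun m => x + (unitVec N m + unitVec N (m + 1))))
    rw [Finset.card_range] at h1 h2
    omega
  · rintro v ⟨m, hm, h | h⟩ <;> rw [vec_eq_of_add_eq h]
    · exact Finset.mem_union_left _ (Finset.mem_image_of_mem _ (Finset.mem_range.2 hm))
    · by_cases hm' : m < N - 1
      · exact Finset.mem_union_right _ (Finset.mem_image.2 ⟨m, Finset.mem_range.2 hm', rfl⟩)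
      · rw [unitVec_of_le (m := m + 1) (by omega), add_zero]
        exact Finset.mem_union_left _ (Finset.mem_image_of_mem _ (Finset.mem_range.2 hm))

/-- The vector with the first three entries `a, b, c`, all others being `0`. -/
def headVec (N : ℕ) (a b c : ZMod 2) : Fin N → ZMod 2 := fun j =>
  if (j : ℕ) = 0 then a else if (j : ℕ) = 1 then b else if (j : ℕ) = 2 then c else 0

theorem headVec_injective {N : ℕ} (hN : 3 ≤ N) {a b c a' b' c' : ZMod 2}
    (h : headVec N a b c = headVec N a' b' c') : a = a' ∧ b = b' ∧ c = c' := by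
  have h0 := congrFun h ⟨0, by omega⟩
  have h1 := congrFun h ⟨1, by omega⟩
  have h2 := congrFun h ⟨2, by omega⟩
  simp [headVec] at h0 h1 h2
  exact ⟨h0, h1, h2⟩

theorem headVec_add (N : ℕ) (a b c a' b' c' : ZMod 2) :
    headVec N a b c + headVec N a' b' c' = headVec N (a + a') (b + b') (c + c') := by
  funext j
  simp only [headVec, Pi.add_apply]
  split_ifs <;> simp

theorem isFlip_headVec {N : ℕ} (hN : 3 ≤ N) :
    IsFlip (headVec N 1 0 0) ∧ IsFlip (headVec N 0 0 1) ∧ IsFlip (headVec N 1 1 0) ∧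
      IsFlip (headVec N 0 1 1) := by
  refine ⟨⟨0, by omega, Or.inl ?_⟩, ⟨2, by omega, Or.inl ?_⟩, ⟨0, by omega, Or.inr ?_⟩,
    ⟨1, by omega, Or.inr ?_⟩⟩ <;> funext j <;> simp only [headVec, unitVec, Pi.add_apply] <;>
    split_ifs <;> first | rfl | omega

/-- The three vertices `0, 101, 111` have four common neighbours. -/
theorem exists_flipGraph_upper {N : ℕ} (hN : 3 ≤ N) :
    ∃ D : Finset (Fin N → ZMod 2), D.card = 3 ∧
      ∀ m, HasDisjointDPaths (flipGraph N) D m → 4 * m + 4 ≤ 3 * (2 * N - 1) := by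
  classical
  have hne : ∀ a b c a' b' c' : ZMod 2, ¬ (a = a' ∧ b = b' ∧ c = c') →
      headVec N a b c ≠ headVec N a' b' c' := fun a b c a' b' c' h h' =>
    h (headVec_injective hN h')
  have hD : ({headVec N 0 0 0, headVec N 1 0 1, headVec N 1 1 1} :
      Finset (Fin N → ZMod 2)).card = 3 := by
    rw [Finset.card_eq_three]
    exact ⟨_, _, _, hne _ _ _ _ _ _ (by decide), hne _ _ _ _ _ _ (by decide),
      hne _ _ _ _ _ _ (by decide), rfl⟩
  refine ⟨_, hD, fun m h => ?_⟩
  have hC : ({headVec N 1 0 0, headVec N 0 0 1, headVec N 1 1 0, headVec N 0 1 1} :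
      Finset (Fin N → ZMod 2)).card = 4 := by
    rw [Finset.card_insert_of_notMem, Finset.card_insert_of_notMem, Finset.card_pair]
    · exact hne _ _ _ _ _ _ (by decide)
    all_goals
      simp only [Finset.mem_insert, Finset.mem_singleton, not_or]
    · exact ⟨hne _ _ _ _ _ _ (by decide), hne _ _ _ _ _ _ (by decide)⟩
    · exact ⟨hne _ _ _ _ _ _ (by decide), hne _ _ _ _ _ _ (by decide),
        hne _ _ _ _ _ _ (by decide)⟩
  have := h.four_mul_add_le hD (fun d _ => flipGraph_degree_le (by omega) d)
    {headVec N 1 0 0, headVec N 0 0 1, headVec N 1 1 0, headVec N 0 1 1} (fun c hc => by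
    have e : (1 : ZMod 2) + 1 = 0 := by decide
    obtain ⟨f1, f2, f3, f4⟩ := isFlip_headVec hN
    simp only [Finset.mem_insert, Finset.mem_singleton] at hc
    constructor
    · simp only [Finset.mem_insert, Finset.mem_singleton, not_or]
      rcases hc with rfl | rfl | rfl | rfl <;>
        exact ⟨hne _ _ _ _ _ _ (by decide), hne _ _ _ _ _ _ (by decide),
          hne _ _ _ _ _ _ (by decide)⟩
    · intro d hd
      simp only [Finset.mem_insert, Finset.mem_singleton] at hd
      rw [flipGraph_adj]
      rcases hc with rfl | rfl | rfl | rfl <;> rcases hd with rfl | rfl | rfl <;>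
        rw [headVec_add] <;> simp only [e, add_zero, zero_add] <;> assumption)
  rwa [hC] at this

end UpperBound

/-! ### The augmented cube in flip coordinates. -/

section Iso

/-- `0, 1` for `false, true`. -/
def boolBit (b : Bool) : ZMod 2 := if b then 1 else 0

/-- The coordinates `x 0, x 0 + x 1, x 1 + x 2, …` of a bit string. -/
def toFlip : (n : ℕ) → (Fin n → Bool) → (Fin n → ZMod 2)
  | 0, _ => 0
  | n + 1, x => Fin.cons (boolBit (x 0)) (toFlip n (Fin.tail x) + boolBit (x 0) • unitVec n 0)

theorem unitVec_succ_zero (n : ℕ) : unitVec (n + 1) 0 = Fin.cons 1 0 := by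
  funext j
  refine Fin.cases ?_ (fun j => ?_) j <;> simp [unitVec]

theorem unitVec_succ_succ (n m : ℕ) : unitVec (n + 1) (m + 1) = Fin.cons 0 (unitVec n m) := by
  funext j
  refine Fin.cases ?_ (fun j => ?_) j <;> simp [unitVec]

theorem cons_add_cons {n : ℕ} (a b : ZMod 2) (d e : Fin n → ZMod 2) :
    (Fin.cons a d + Fin.cons b e : Fin (n + 1) → ZMod 2) = Fin.cons (a + b) (d + e) := by
  funext j
  refine Fin.cases ?_ (fun j => ?_) j <;> simp

theorem isFlip_cons_zero {n : ℕ} (d : Fin n → ZMod 2) :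
    IsFlip (Fin.cons 0 d : Fin (n + 1) → ZMod 2) ↔ IsFlip d := by
  constructor
  · rintro ⟨_ | m, hm, h | h⟩
    · rw [unitVec_succ_zero, Fin.cons_inj] at h
      exact absurd h.1 (by decide)
    · rw [unitVec_succ_zero, unitVec_succ_succ, cons_add_cons, Fin.cons_inj] at h
      exact absurd h.1 (by decide)
    · rw [unitVec_succ_succ, Fin.cons_inj] at h
      exact ⟨m, by omega, Or.inl h.2⟩
    · rw [unitVec_succ_succ, unitVec_succ_succ, cons_add_cons, Fin.cons_inj] at h
      exact ⟨m, by omega, Or.inr h.2⟩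
  · rintro ⟨m, hm, rfl | rfl⟩
    · exact ⟨m + 1, by omega, Or.inl (by rw [unitVec_succ_succ])⟩
    · exact ⟨m + 1, by omega, Or.inr (by
        rw [unitVec_succ_succ, unitVec_succ_succ, cons_add_cons, add_zero])⟩

theorem isFlip_cons_one {n : ℕ} (d : Fin n → ZMod 2) :
    IsFlip (Fin.cons 1 d : Fin (n + 1) → ZMod 2) ↔ d = 0 ∨ d = unitVec n 0 := by
  constructor
  · rintro ⟨_ | m, hm, h | h⟩
    · rw [unitVec_succ_zero, Fin.cons_inj] at h
      exact Or.inl h.2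
    · rw [unitVec_succ_zero, unitVec_succ_succ, cons_add_cons, Fin.cons_inj, zero_add] at h
      exact Or.inr h.2
    · rw [unitVec_succ_succ, Fin.cons_inj] at h
      exact absurd h.1 (by decide)
    · rw [unitVec_succ_succ, unitVec_succ_succ, cons_add_cons, Fin.cons_inj] at h
      exact absurd h.1 (by decide)
  · rintro (rfl | rfl)
    · exact ⟨0, by omega, Or.inl (by rw [unitVec_succ_zero])⟩
    · exact ⟨0, by omega, Or.inr (by
        rw [unitVec_succ_zero, unitVec_succ_succ, cons_add_cons, zero_add, add_zero])⟩

theorem boolBit_injective : Function.Injective boolBit := by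
  intro a b; revert a b; decide

theorem toFlip_injective : ∀ n, Function.Injective (toFlip n)
  | 0 => fun x y _ => Subsingleton.elim x y
  | n + 1 => fun x y h => by
    rw [toFlip, toFlip, Fin.cons_inj] at h
    obtain ⟨h0, h1⟩ := h
    rw [h0] at h1
    have h2 := toFlip_injective n (add_right_cancel h1)
    rw [← Fin.cons_self_tail x, ← Fin.cons_self_tail y, h2, boolBit_injective h0]

/-- Complementing all bits leaves the sums of consecutive bits unchanged and alters only the first
coordinate. -/
theorem toFlip_compl : ∀ n (x : Fin n → Bool),
    toFlip n (fun i => !(x i)) = toFlip n x + unitVec n 0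
  | 0, x => Subsingleton.elim _ _
  | n + 1, x => by
    have h : Fin.tail (fun i => !(x i)) = fun i => !(Fin.tail x i) := rfl
    have hb : boolBit (!(x 0)) = boolBit (x 0) + 1 := by
      generalize x 0 = b
      revert b
      decide
    rw [toFlip, toFlip, h, toFlip_compl n, hb, unitVec_succ_zero, cons_add_cons, add_zero,
      add_smul, one_smul]
    congr 1
    rw [add_assoc, add_comm (boolBit (x 0) • unitVec n 0), ← add_assoc (unitVec n 0),
      vec_add_self, zero_add]

/-- If the first bits differ, the remaining coordinates of the sum are those of the two tails plus
e_0. They give 0 exactly for a complementary edge and e_0 exactly for a hypercubic one. -/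
theorem isFlip_toFlip : ∀ n (x y : Fin n → Bool),
    IsFlip (toFlip n x + toFlip n y) ↔ AugAdj n x y
  | 0, x, y => by
    constructor
    · rintro ⟨m, hm, -⟩
      omega
    · exact fun h => h.elim
  | n + 1, x, y => by
    rw [toFlip, toFlip, cons_add_cons, AugAdj]
    by_cases h0 : x 0 = y 0
    · have e : toFlip n (Fin.tail x) + boolBit (y 0) • unitVec n 0 +
          (toFlip n (Fin.tail y) + boolBit (y 0) • unitVec n 0) =
          toFlip n (Fin.tail x) + toFlip n (Fin.tail y) := by
        rw [add_add_add_comm, vec_add_self, add_zero]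
      rw [h0, CharTwo.add_self_eq_zero, e, isFlip_cons_zero, isFlip_toFlip n]
      simp
    · have hb : boolBit (x 0) + boolBit (y 0) = 1 := by
        revert h0
        generalize x 0 = a
        generalize y 0 = b
        revert a b
        decide
      have e : toFlip n (Fin.tail x) + boolBit (x 0) • unitVec n 0 +
          (toFlip n (Fin.tail y) + boolBit (y 0) • unitVec n 0) =
          toFlip n (Fin.tail x) + toFlip n (Fin.tail y) + unitVec n 0 := by
        rw [add_add_add_comm, ← add_smul, hb, one_smul]
      have hadd : ∀ a b c : Fin n → ZMod 2, a + b + c = 0 ↔ b = a + c := by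
        intro a b c
        constructor
        · intro h
          have h1 : a + (b + c) = 0 := by rw [← add_assoc, h]
          have h2 := vec_eq_of_add_eq h1
          rw [add_zero, add_comm] at h2
          rw [add_comm]
          exact vec_eq_of_add_eq h2
        · rintro rfl
          rw [vec_add_cancel, vec_add_self]
      have hadd' : ∀ a b c : Fin n → ZMod 2, a + b + c = c ↔ b = a := by
        intro a b c
        rw [add_eq_right]
        constructor
        · intro h
          have := vec_eq_of_add_eq h
          rwa [add_zero] at this
        · rintro rfl
          exact vec_add_self _
      rw [hb, e, isFlip_cons_one, hadd, hadd', ← toFlip_compl, (toFlip_injective n).eq_iff,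
        (toFlip_injective n).eq_iff]
      simp only [h0, false_and, false_or, ne_eq, not_false_eq_true, true_and]
      exact or_comm

/-- The augmented cube in flip coordinates. -/
noncomputable def augmentedCubeIso (n : ℕ) : augmentedCube n ≃g flipGraph n where
  toEquiv := Equiv.ofBijective (toFlip n) ((Fintype.bijective_iff_injective_and_card _).2
    ⟨toFlip_injective n, by simp⟩)
  map_rel_iff' := by
    intro x y
    exact isFlip_toFlip n x y

end Iso

/-! ### Transfer to the augmented cube and conclusion. -/

theorem map_equiv_symm_map {V V' : Type*} (f : V ≃ V') (D : Finset V) :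
    (D.map f.toEmbedding).map f.symm.toEmbedding = D := by
  ext v
  simp

theorem mainTheorem2 (n : ℕ) (hodd : Odd n) (hn : 3 ≤ n) :
    pathConnectivity 3 (augmentedCube n) = ((3 * (n - 1) / 2 - 1 : ℕ) : ℕ∞) := by
  obtain ⟨k, rfl⟩ := hodd
  have hval : 3 * (2 * k + 1 - 1) / 2 - 1 = 3 * k - 1 := by omega
  rw [hval]
  apply le_antisymm
  · obtain ⟨D, hD, hupper⟩ := exists_flipGraph_upper hn
    have hle : pathConnectivity 3 (augmentedCube (2 * k + 1)) ≤ pathNumber _ _ :=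
      sInf_le ⟨D.map (augmentedCubeIso (2 * k + 1)).symm.toEquiv.toEmbedding,
        by rw [Finset.card_map, hD], rfl⟩
    refine hle.trans (sSup_le ?_)
    rintro _ ⟨m, rfl, hm⟩
    have h1 := hm.map (augmentedCubeIso (2 * k + 1))
    have h2 := map_equiv_symm_map (augmentedCubeIso (2 * k + 1)).symm.toEquiv D
    change HasDisjointDPaths _ ((D.map _).map (augmentedCubeIso (2 * k + 1)).symm.toEquiv.symm.toEmbedding) m at h1
    rw [h2] at h1
    -- This reads 4m + 4 ≤ 12k + 3, and integrality gives m ≤ 3k - 1.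
    have := hupper m h1
    exact_mod_cast (by omega : m ≤ 3 * k - 1)
  · refine le_sInf ?_
    rintro _ ⟨D, hD, rfl⟩
    unfold pathNumber
    refine le_sSup ⟨3 * k - 1, rfl, ?_⟩
    have h1 := (flipGraph_hasDisjointDPaths (by omega) rfl
      (D.map (augmentedCubeIso (2 * k + 1)).toEquiv.toEmbedding)
      (by rw [Finset.card_map, hD])).map (augmentedCubeIso (2 * k + 1)).symm
    rwa [show (augmentedCubeIso (2 * k + 1)).symm.toEquiv =
      (augmentedCubeIso (2 * k + 1)).toEquiv.symm from rfl, map_equiv_symm_map] at h1
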